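/- Let $\mathbb{T}=\mathbb{R}/2\pi\mathbb{Z}$, and for $f:\mathbb{T}\to\mathbb{R}$ and $\alpha\in(0,1)$ put $$\|f\|_{C^\alpha}=\|f\|_{L^\infty}+\sup_{x\neq y}\frac{|f(x)-f(y)|}{|x-y|^\alpha},\qquad C^\alpha=\{f:\|f\|_{C^\alpha}<\infty\},$$ where $|x-y|$ is the distance on $\mathbb{T}$. Let $\hat f(n)=\frac1{2\pi}\int_{\mathbb{T}}f(x)e^{-inx}\,dx$, let $P_Nf=\sum_{|n|\le N}\hat f(n)e^{inx}$ for $N\in\{0,1,2,\dots\}$ and $P_\infty=\mathrm{Id}$, and let $|D_x|^\beta$ be the Fourier multiplier with symbol $|n|^\beta$. Fix $\beta>1$. For $N\in\{0,1,2,\dots\}\cup\{\infty\}$ consider, for real-valued $u$, $$\partial_t u+\partial_t|D_x|^\beta u+\partial_x u+\partial_xP_N\big((P_Nu)^2\big)=0,\qquad u(0,x)=u_0(x). \tag{$\ast_N$}$$ For $N<\infty$ this is the truncated fractional BBM equation, and for $N=\infty$ it is the full equation $\partial_t u+\partial_t|D_x|^\beta u+\partial_x u+\partial_x(u^2)=0$.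 A solution on $[0,T]$ is a function $u\in C([0,T];C^\alpha)$ with $u(0)=u_0$ that satisfies the equation in the sense of periodic distributions in $x$: for each $n\in\mathbb{Z}$, the map $t\mapsto\hat u(t,n)$ is differentiable on $[0,T]$ (one-sidedly at the end points), and $$(1+|n|^\beta)\,\partial_t\hat u(t,n)+in\,\hat u(t,n)+in\,\big[P_N((P_Nu(t))^2)\big]^{\wedge}(n)=0\qquad\text{for all }t\in[0,T].$$ **Proposition.** Let $\alpha\in(0,1)$ and $\beta>1$. There is a constant $c>0$, depending only on $\alpha$ and $\beta$ (in particular independent of $N$), such that the following holds for every $N\in\{0,1,2,\dots\}\cup\{\infty\}$ and every $K>0$. Let $u_0:\mathbb{T}\to\mathbb{R}$ satisfy $\|u_0\|_{C^\alpha}\le K$, and put $T=\frac{c}{1+K}$. Then $(\ast_N)$ has a unique solution $u\in C([0,T];C^\alpha)$ on $[0,T]$, and $$\sup_{t\in[0,T]}\|u(t)\|_{C^\alpha}\le 2K.$$ -/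

import Mathlib

open Set Filter Topology
open scoped ENNReal

noncomputable section

/-- The flat torus `ℝ / 2πℤ`. -/
abbrev Torus : Type := AddCircle (2 * Real.pi)

instance torusPeriodPos : Fact ((0 : ℝ) < 2 * Real.pi) := ⟨Real.two_pi_pos⟩

/-- The Hölder norm `‖f‖_{L^∞} + sup_{x ≠ y} |f x - f y| / |x - y| ^ α`, as an extended
nonnegative number; `dist` is the distance of the torus `ℝ / 2πℤ`. Finiteness (for `0 < α`)
forces `f` to be continuous, so that its `L^∞` norm is the supremum over all points. -/
def holderNorm (α : ℝ) (f : Torus → ℝ) : ℝ≥0∞ :=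
  (⨆ x : Torus, ENNReal.ofReal |f x|) +
    ⨆ (x : Torus) (y : Torus) (_ : x ≠ y), ENNReal.ofReal (|f x - f y| / dist x y ^ α)

/-- The space `C^α` of real functions on the torus. -/
def holderSpace (α : ℝ) : Set (Torus → ℝ) := {f | holderNorm α f < ∞}

/-- `u ∈ C([0,T]; C^α)`: on `[0,T]` the function `u` takes values in `C^α` and is continuous
for the distance given by the `C^α` norm. Values of `u` outside `[0,T]` play no role. -/
def ContinuousInHolder (α T : ℝ) (u : ℝ → Torus → ℝ) : Prop :=
  (∀ t ∈ Icc 0 T, u t ∈ holderSpace α) ∧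
    ∀ t ∈ Icc 0 T, Tendsto (fun s => holderNorm α (u s - u t)) (𝓝[Icc 0 T] t) (𝓝 0)

/-- A real function on the torus, seen as a complex one. -/
def toComplexFun (f : Torus → ℝ) : Torus → ℂ := fun x => (f x : ℂ)

/-- The projection `P_N f = ∑_{|n| ≤ N} f̂(n) e^{inx}` for finite `N`, and `P_∞ = Id`. -/
def freqProj : ℕ∞ → (Torus → ℂ) → Torus → ℂ
  | none, f => f
  | some N, f => fun x => ∑ n ∈ Finset.Icc (-(N : ℤ)) (N : ℤ), fourierCoeff f n * fourier n x

/-- The function `P_N ((P_N f) ^ 2)`. For `N = ∞` it is `f ^ 2`. -/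
def truncatedSquare (N : ℕ∞) (f : Torus → ℝ) : Torus → ℂ :=
  freqProj N (fun x => freqProj N (toComplexFun f) x ^ 2)

/-- `u ∈ C([0,T]; C^α)` solves
`∂_t u + ∂_t |D_x|^β u + ∂_x u + ∂_x P_N ((P_N u) ^ 2) = 0`, `u(0) = u₀`, on `[0,T]`.

The equation is one between periodic distributions in `x`, that is, between all their Fourier
coefficients, where `∂_x` multiplies the `n`-th coefficient by `i n` and `|D_x|^β` multiplies it
by `|n| ^ β`. The time derivative of each coefficient is one-sided at `0` and at `T`. -/
structure IsBBMSolution (α β : ℝ) (N : ℕ∞) (T : ℝ) (u₀ : Torus → ℝ)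
    (u : ℝ → Torus → ℝ) : Prop where
  continuous : ContinuousInHolder α T u
  initial : u 0 = u₀
  equation : ∀ t ∈ Icc 0 T, ∀ n : ℤ, ∃ d : ℂ,
    HasDerivWithinAt (fun s => fourierCoeff (toComplexFun (u s)) n) d (Icc 0 T) t ∧
      d + ((|(n : ℝ)| ^ β : ℝ) : ℂ) * d
        + Complex.I * n * fourierCoeff (toComplexFun (u t)) n
        + Complex.I * n * fourierCoeff (truncatedSquare N (u t)) n = 0

end

noncomputable section

open MeasureTheory AddCircle

/-! Applying `(1 + |D|^β)⁻¹` turns the equation into the ODE `u' = F(u)` in `C^α`, where `F(u) = -(1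
+ |D|^β)⁻¹ ∂_x (u + P_N (P_N u)²)`. If `F` is quadratically bounded and locally Lipschitz with
constants independent of `N`, Picard iteration on the ball of radius `K` about `u₀` gives existence
on a time of order `1 / (1 + K)`, and Grönwall's inequality gives uniqueness.

The difficulty is uniformity in `N`, since the `P_N` are not uniformly bounded on `C^α`. They do map
`C^α` to `C^(α - ε)` uniformly, and the multiplier, of order `1 - β < 0`, recovers the loss.
Everything rests on the one-sided partial sums `S_n g` over the frequencies `1, …, n`. For `g` in
`C^γ` their kernel is at most `π / ‖z‖`, so they are bounded uniformly in `n`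
(`norm_posPartialSum_le`). Applied to increments of `g`, this gives a `C^(γ - ε)` bound; a
Bernstein-type argument gives a Lipschitz bound growing like `n`; interpolation gives a gain of
regularity at the price `n^θ` (`norm_posPartialSum_sub_le`).

Summation by parts writes the multiplier as a sum of `2 Im S_n g` weighted by the decrements of its
symbol. These are `O(n^(-β))`, apart from one jump at `n = N`, so the price `n^θ` is affordable when
`θ < β - 1`. The exponents can be tuned to land exactly in `C^α` (`exists_exponents`).

A distributional solution is only known through its Fourier coefficients. It coincides with the time
integral of `F(u)`, whose coefficients are the same, and hence is differentiable in `C^α`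
(`hasDerivWithinAt_of_fourierCoeff`). -/

/-! ### Hölder bounds and the Banach space `C^α` -/

/-- `g` is Hölder continuous with exponent `γ` and constant `A`. -/
def HolderBound (γ A : ℝ) (g : Torus → ℝ) : Prop := ∀ x y, |g x - g y| ≤ A * dist x y ^ γ

lemma HolderBound.continuous {γ A : ℝ} (hγ : 0 < γ) {g : Torus → ℝ} (h : HolderBound γ A g) :
    Continuous g := by
  rw [continuous_iff_continuousAt]
  intro x
  rw [ContinuousAt, tendsto_iff_dist_tendsto_zero]
  have h0 : Tendsto (fun y : Torus => A * dist y x ^ γ) (𝓝 x) (𝓝 0) := by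
    have : Continuous (fun y : Torus => A * dist y x ^ γ) :=
      continuous_const.mul ((continuous_id.dist continuous_const).rpow_const
        (fun _ => Or.inr hγ.le))
    have h1 := this.tendsto x
    simpa [Real.zero_rpow hγ.ne'] using h1
  exact squeeze_zero (fun _ => dist_nonneg) (fun y => h y x) h0

lemma HolderBound.add {γ A B : ℝ} {f g : Torus → ℝ} (hf : HolderBound γ A f)
    (hg : HolderBound γ B g) : HolderBound γ (A + B) (f + g) := by
  intro x y
  have h1 := hf x y
  have h2 := hg x y
  calc |(f + g) x - (f + g) y| = |(f x - f y) + (g x - g y)| := by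
        congr 1; simp only [Pi.add_apply]; ring
    _ ≤ |f x - f y| + |g x - g y| := abs_add_le _ _
    _ ≤ _ := by rw [add_mul]; linarith

lemma HolderBound.smul {γ A : ℝ} {f : Torus → ℝ} (hf : HolderBound γ A f) (c : ℝ) :
    HolderBound γ (|c| * A) (c • f) := by
  intro x y
  have h1 := hf x y
  calc |(c • f) x - (c • f) y| = |c| * |f x - f y| := by
        rw [← abs_mul]; congr 1; simp only [Pi.smul_apply, smul_eq_mul]; ring
    _ ≤ |c| * (A * dist x y ^ γ) := by gcongr
    _ = _ := by ring

lemma holderNorm_le {α A B : ℝ} {f : Torus → ℝ} (hA0 : 0 ≤ A) (hB0 : 0 ≤ B)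
    (hA : ∀ x, |f x| ≤ A) (hB : HolderBound α B f) :
    holderNorm α f ≤ ENNReal.ofReal (A + B) := by
  rw [ENNReal.ofReal_add hA0 hB0, holderNorm]
  refine add_le_add (iSup_le fun x => ENNReal.ofReal_le_ofReal (hA x))
    (iSup_le fun x => iSup_le fun y => iSup_le fun hxy => ENNReal.ofReal_le_ofReal ?_)
  rw [div_le_iff₀ (Real.rpow_pos_of_pos (dist_pos.2 hxy) _)]
  exact hB x y

lemma exists_bounds_of_mem_holderSpace {α : ℝ} {f : Torus → ℝ} (hf : f ∈ holderSpace α) :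
    ∃ A B : ℝ, 0 ≤ A ∧ 0 ≤ B ∧ (∀ x, |f x| ≤ A) ∧ HolderBound α B f ∧
      (holderNorm α f).toReal = A + B := by
  have hf' : holderNorm α f < ∞ := hf
  rw [holderNorm, ENNReal.add_lt_top] at hf'
  obtain ⟨h1, h2⟩ := hf'
  refine ⟨_, _, ENNReal.toReal_nonneg, ENNReal.toReal_nonneg, fun x => ?_, fun x y => ?_,
    ENNReal.toReal_add h1.ne h2.ne⟩
  · rw [← ENNReal.ofReal_le_iff_le_toReal h1.ne]
    exact le_iSup (fun x : Torus => ENNReal.ofReal |f x|) x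
  · rcases eq_or_ne x y with rfl | hxy
    · simp only [sub_self, abs_zero]
      positivity
    · rw [← div_le_iff₀ (Real.rpow_pos_of_pos (dist_pos.2 hxy) _),
        ← ENNReal.ofReal_le_iff_le_toReal h2.ne]
      exact le_iSup_of_le x (le_iSup_of_le y (le_iSup_of_le hxy le_rfl))

lemma mem_holderSpace_of_bounds {α A B : ℝ} {f : Torus → ℝ} (hA0 : 0 ≤ A) (hB0 : 0 ≤ B)
    (hA : ∀ x, |f x| ≤ A) (hB : HolderBound α B f) : f ∈ holderSpace α :=
  (holderNorm_le hA0 hB0 hA hB).trans_lt ENNReal.ofReal_lt_top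

lemma toReal_holderNorm_le {α A B : ℝ} {f : Torus → ℝ} (hA0 : 0 ≤ A) (hB0 : 0 ≤ B)
    (hA : ∀ x, |f x| ≤ A) (hB : HolderBound α B f) : (holderNorm α f).toReal ≤ A + B :=
  ENNReal.toReal_le_of_le_ofReal (by positivity) (holderNorm_le hA0 hB0 hA hB)

/-- The space `C^α` as a submodule of all functions. -/
def holderSubmodule (α : ℝ) : Submodule ℝ (Torus → ℝ) where
  carrier := holderSpace α
  zero_mem' := mem_holderSpace_of_bounds (A := 0) (B := 0) le_rfl le_rfl (by simp)
    (fun x y => by simp)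
  add_mem' {f g} hf hg := by
    obtain ⟨A, B, hA0, hB0, hA, hB, -⟩ := exists_bounds_of_mem_holderSpace hf
    obtain ⟨A', B', hA0', hB0', hA', hB', -⟩ := exists_bounds_of_mem_holderSpace hg
    exact mem_holderSpace_of_bounds (add_nonneg hA0 hA0') (add_nonneg hB0 hB0')
      (fun x => (abs_add_le _ _).trans (add_le_add (hA x) (hA' x))) (hB.add hB')
  smul_mem' c f hf := by
    obtain ⟨A, B, hA0, hB0, hA, hB, -⟩ := exists_bounds_of_mem_holderSpace hf
    refine mem_holderSpace_of_bounds (A := |c| * A) (B := |c| * B) (by positivity)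
      (by positivity) (fun x => ?_) (hB.smul c)
    rw [Pi.smul_apply, smul_eq_mul, abs_mul]
    exact mul_le_mul_of_nonneg_left (hA x) (abs_nonneg c)

/-- The space `C^α` of real functions on the torus, as a type. -/
def HolderFun (α : ℝ) : Type := holderSubmodule α

namespace HolderFun

variable {α : ℝ}

instance : AddCommGroup (HolderFun α) := inferInstanceAs (AddCommGroup (holderSubmodule α))
instance : Module ℝ (HolderFun α) := inferInstanceAs (Module ℝ (holderSubmodule α))
instance : CoeFun (HolderFun α) (fun _ => Torus → ℝ) := ⟨fun f => f.1⟩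

/-- The element of `HolderFun α` given by a function in `C^α`. -/
def of (f : Torus → ℝ) (hf : f ∈ holderSpace α) : HolderFun α := ⟨f, hf⟩

@[simp] lemma coe_of (f : Torus → ℝ) (hf : f ∈ holderSpace α) : (of f hf : Torus → ℝ) = f := rfl

lemma mem (f : HolderFun α) : (f : Torus → ℝ) ∈ holderSpace α := f.2

@[ext] lemma ext {f g : HolderFun α} (h : ∀ x, f x = g x) : f = g := Subtype.ext (funext h)

@[simp] lemma coe_zero : ((0 : HolderFun α) : Torus → ℝ) = 0 := rfl
@[simp] lemma coe_add (f g : HolderFun α) : ((f + g : HolderFun α) : Torus → ℝ) = f + g := rfl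
@[simp] lemma coe_sub (f g : HolderFun α) : ((f - g : HolderFun α) : Torus → ℝ) = f - g := rfl
@[simp] lemma coe_smul (c : ℝ) (f : HolderFun α) :
    ((c • f : HolderFun α) : Torus → ℝ) = c • (f : Torus → ℝ) := rfl

/-- The norm is put on a separate type because the submodule itself would inherit the topology of
pointwise convergence. -/
instance : Norm (HolderFun α) := ⟨fun f => (holderNorm α f).toReal⟩

lemma holderNorm_eq (f : HolderFun α) : holderNorm α f = ENNReal.ofReal ‖f‖ :=
  (ENNReal.ofReal_toReal (ne_of_lt f.mem)).symm

lemma exists_bounds (f : HolderFun α) : ∃ A B : ℝ, 0 ≤ A ∧ 0 ≤ B ∧ (∀ x, |f x| ≤ A) ∧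
    HolderBound α B f ∧ ‖f‖ = A + B :=
  exists_bounds_of_mem_holderSpace f.mem

lemma norm_le {A B : ℝ} {f : HolderFun α} (hA0 : 0 ≤ A) (hB0 : 0 ≤ B)
    (hA : ∀ x, |f x| ≤ A) (hB : HolderBound α B f) : ‖f‖ ≤ A + B :=
  toReal_holderNorm_le hA0 hB0 hA hB

lemma abs_apply_le (f : HolderFun α) (x : Torus) : |f x| ≤ ‖f‖ := by
  obtain ⟨A, B, _, _, hA, _, h⟩ := f.exists_bounds
  linarith [hA x]

lemma holderBound (f : HolderFun α) : HolderBound α ‖f‖ f := by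
  obtain ⟨A, B, _, _, _, hB, h⟩ := f.exists_bounds
  intro x y
  refine (hB x y).trans ?_
  gcongr
  linarith

lemma smul_norm_le (c : ℝ) (f : HolderFun α) : ‖c • f‖ ≤ |c| * ‖f‖ := by
  obtain ⟨A, B, hA0, hB0, hA, hB, h⟩ := f.exists_bounds
  rw [h, mul_add]
  refine norm_le (by positivity) (by positivity) (fun x => ?_) (hB.smul c)
  rw [coe_smul, Pi.smul_apply, smul_eq_mul, abs_mul]
  exact mul_le_mul_of_nonneg_left (hA x) (abs_nonneg c)

instance : NormedAddCommGroup (HolderFun α) :=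
  AddGroupNorm.toNormedAddCommGroup
    { toFun := fun f => ‖f‖
      map_zero' := le_antisymm (by
          simpa using norm_le (f := (0 : HolderFun α)) (A := 0) (B := 0) le_rfl le_rfl (by simp)
            (fun x y => by simp)) ENNReal.toReal_nonneg
      add_le' := fun f g => by
        obtain ⟨A, B, hA0, hB0, hA, hB, h⟩ := f.exists_bounds
        obtain ⟨A', B', hA0', hB0', hA', hB', h'⟩ := g.exists_bounds
        have := norm_le (f := f + g) (add_nonneg hA0 hA0') (add_nonneg hB0 hB0')
          (fun x => (abs_add_le _ _).trans (add_le_add (hA x) (hA' x))) (hB.add hB')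
        linarith
      neg' := fun f => le_antisymm (by simpa using smul_norm_le (-1) f)
        (by simpa using smul_norm_le (-1) (-f))
      eq_zero_of_map_eq_zero' := fun f hf => by
        ext x
        have h1 : |f x| ≤ ‖f‖ := f.abs_apply_le x
        have h2 : ‖f‖ = 0 := hf
        simpa [h2] using h1 }

instance : NormedSpace ℝ (HolderFun α) where
  norm_smul_le c f := smul_norm_le c f

lemma continuous_coe (hα : 0 < α) (f : HolderFun α) : Continuous (f : Torus → ℝ) :=
  f.holderBound.continuous hα

instance : CompleteSpace (HolderFun α) := by
  refine Metric.complete_of_cauchySeq_tendsto fun u hu => ?_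
  have hpt : ∀ x, ∃ l, Tendsto (fun n => u n x) atTop (𝓝 l) := fun x => by
    refine cauchySeq_tendsto_of_complete (Metric.cauchySeq_iff.2 fun ε hε => ?_)
    obtain ⟨N, hN⟩ := Metric.cauchySeq_iff.1 hu ε hε
    refine ⟨N, fun m hm n hn => lt_of_le_of_lt ?_ (hN m hm n hn)⟩
    rw [dist_eq_norm, dist_eq_norm]
    exact (u m - u n).abs_apply_le x
  choose f hf using hpt
  -- Both parts of the norm are suprema of pointwise expressions, so the Cauchy bounds survive the
  -- pointwise limit in `m`.
  have key : ∀ ε > 0, ∃ N, ∀ n ≥ N, (∀ x, |u n x - f x| ≤ ε) ∧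
      HolderBound α ε ((u n : Torus → ℝ) - f) := fun ε hε => by
    obtain ⟨N, hN⟩ := Metric.cauchySeq_iff.1 hu ε hε
    refine ⟨N, fun n hn => ⟨fun x => ?_, fun x y => ?_⟩⟩
    · refine le_of_tendsto ((tendsto_const_nhds.sub (hf x)).abs)
        (eventually_atTop.2 ⟨N, fun m hm => ?_⟩)
      have h1 := (hN n hn m hm).le
      rw [dist_eq_norm] at h1
      exact ((u n - u m).abs_apply_le x).trans h1
    · refine le_of_tendsto (((tendsto_const_nhds.sub (hf x)).sub
        (tendsto_const_nhds.sub (hf y))).abs) (eventually_atTop.2 ⟨N, fun m hm => ?_⟩)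
      have h1 := (hN n hn m hm).le
      rw [dist_eq_norm] at h1
      refine ((u n - u m).holderBound x y).trans ?_
      gcongr
  have hmem : f ∈ holderSpace α := by
    obtain ⟨N, hN⟩ := key 1 one_pos
    obtain ⟨h1, h2⟩ := hN N le_rfl
    have : (u N : Torus → ℝ) - f ∈ holderSubmodule α :=
      mem_holderSpace_of_bounds zero_le_one zero_le_one h1 h2
    have h3 := (holderSubmodule α).sub_mem (u N).2 this
    rwa [sub_sub_cancel] at h3
  refine ⟨of f hmem, Metric.tendsto_atTop.2 fun ε hε => ?_⟩
  obtain ⟨N, hN⟩ := key (ε / 3) (by positivity)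
  refine ⟨N, fun n hn => ?_⟩
  obtain ⟨h1, h2⟩ := hN n hn
  rw [dist_eq_norm]
  have := norm_le (f := u n - of f hmem) (by positivity) (by positivity) h1 h2
  linarith

end HolderFun

/-! ### Characters of the circle and the one-sided Dirichlet kernel -/

namespace Torus

lemma exists_real_rep (z : Torus) :
    ∃ x : ℝ, (x : Torus) = z ∧ |x| = ‖z‖ ∧ |x| ≤ Real.pi := by
  induction z using QuotientAddGroup.induction_on with
  | H x =>
    have h : ‖(x : Torus)‖ = |x - round ((2 * Real.pi)⁻¹ * x) * (2 * Real.pi)| :=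
      AddCircle.norm_eq (2 * Real.pi)
    refine ⟨x - round ((2 * Real.pi)⁻¹ * x) * (2 * Real.pi), ?_, h.symm, ?_⟩
    · rw [AddCircle.coe_sub, ← zsmul_eq_mul, AddCircle.coe_zsmul, AddCircle.coe_period, smul_zero,
        sub_zero]
    · rw [← h]
      refine (AddCircle.norm_le_half_period _ Real.two_pi_pos.ne').trans ?_
      rw [abs_of_pos Real.two_pi_pos]
      linarith

lemma norm_le_pi (z : Torus) : ‖z‖ ≤ Real.pi := by
  obtain ⟨x, -, h1, h2⟩ := exists_real_rep z
  rwa [← h1]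

lemma fourier_one_coe (x : ℝ) : (fourier 1 (x : Torus) : ℂ) = Complex.exp (Complex.I * x) := by
  rw [fourier_coe_apply]
  congr 1
  have : (Real.pi : ℂ) ≠ 0 := by exact_mod_cast Real.pi_ne_zero
  push_cast
  field_simp

lemma norm_fourier_one_sub_one_le (z : Torus) : ‖(fourier 1 z : ℂ) - 1‖ ≤ ‖z‖ := by
  obtain ⟨x, rfl, h1, -⟩ := exists_real_rep z
  rw [fourier_one_coe, ← h1]
  exact Real.norm_exp_I_mul_ofReal_sub_one_le

/-- The chord has length `2 |sin (x / 2)|`, and Jordan's inequality bounds the sine from below on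
`|x| ≤ π`. -/
lemma le_norm_fourier_one_sub_one (z : Torus) :
    2 / Real.pi * ‖z‖ ≤ ‖(fourier 1 z : ℂ) - 1‖ := by
  obtain ⟨x, rfl, h1, h2⟩ := exists_real_rep z
  rw [fourier_one_coe, ← h1, Complex.norm_exp_I_mul_ofReal_sub_one, norm_mul, Real.norm_eq_abs,
    Real.norm_eq_abs, abs_two]
  have := Real.mul_abs_le_abs_sin (x := x / 2) (by rw [abs_div, abs_two]; linarith)
  rw [abs_div, abs_two] at this
  linarith

lemma norm_fourier_apply (n : ℤ) (z : Torus) : ‖(fourier n z : ℂ)‖ = 1 := by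
  rw [fourier_apply, Circle.norm_coe]

lemma fourier_natCast (n : ℕ) (z : Torus) : (fourier (n : ℤ) z : ℂ) = (fourier 1 z) ^ n := by
  induction n with
  | zero => simp
  | succ n ih => rw [Nat.cast_succ, fourier_add, ih, pow_succ]

lemma fourier_natCast_succ (n : ℕ) (z : Torus) :
    (fourier ((n : ℤ) + 1) z : ℂ) = (fourier 1 z) ^ (n + 1) := by
  rw [← fourier_natCast]; push_cast; rfl

lemma fourier_sub_apply (n : ℤ) (x y : Torus) :
    (fourier n (x - y) : ℂ) = fourier n x * fourier (-n) y := by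
  rw [sub_eq_add_neg]
  simp [fourier_apply, smul_add, toCircle_add]

lemma fourier_add_apply (n : ℤ) (x y : Torus) :
    (fourier n (x + y) : ℂ) = fourier n x * fourier n y := by
  simp [fourier_apply, smul_add, toCircle_add]

/-- A geometric sum: times `ω - 1` it has modulus at most `2`, while `|ω - 1| ≥ (2 / π) ‖z‖`. -/
lemma norm_mul_norm_kernel_le (n : ℕ) (z : Torus) :
    ‖z‖ * ‖∑ j ∈ Finset.range n, (fourier ((j : ℤ) + 1) z : ℂ)‖ ≤ Real.pi := by
  set ω : ℂ := fourier 1 z with hω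
  have hω1 : ‖ω‖ = 1 := norm_fourier_apply 1 z
  have h1 : (∑ j ∈ Finset.range n, (fourier ((j : ℤ) + 1) z : ℂ)) * (ω - 1)
      = ω * (ω ^ n - 1) := by
    rw [← geom_sum_mul, ← mul_assoc, Finset.mul_sum]
    congr 1
    refine Finset.sum_congr rfl fun j _ => ?_
    rw [fourier_natCast_succ, pow_succ, mul_comm]
  have h2 : ‖∑ j ∈ Finset.range n, (fourier ((j : ℤ) + 1) z : ℂ)‖ * ‖ω - 1‖ ≤ 2 := by
    rw [← norm_mul, h1, norm_mul, hω1, one_mul]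
    refine (norm_sub_le _ _).trans ?_
    rw [norm_pow, hω1, one_pow, norm_one]
    norm_num
  have h3 := le_norm_fourier_one_sub_one z
  have hpi := Real.pi_pos
  have h4 : ‖∑ j ∈ Finset.range n, (fourier ((j : ℤ) + 1) z : ℂ)‖ * (2 / Real.pi * ‖z‖) ≤ 2 :=
    (mul_le_mul_of_nonneg_left h3 (norm_nonneg _)).trans h2
  have h5 : ‖z‖ * ‖∑ j ∈ Finset.range n, (fourier ((j : ℤ) + 1) z : ℂ)‖ =
      Real.pi / 2 * (‖∑ j ∈ Finset.range n, (fourier ((j : ℤ) + 1) z : ℂ)‖ *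
        (2 / Real.pi * ‖z‖)) := by
    field_simp
  rw [h5]
  calc _ ≤ Real.pi / 2 * 2 := by gcongr
    _ = _ := by ring

lemma integrable_norm_rpow {ε : ℝ} (hε : 0 < ε) :
    Integrable (fun z : Torus => ‖z‖ ^ (ε - 1)) haarAddCircle := by
  have hpi := Real.pi_pos
  have h0 : IntervalIntegrable (fun x : ℝ => |x| ^ (ε - 1)) volume 0 Real.pi := by
    refine (intervalIntegral.intervalIntegrable_rpow' (r := ε - 1) (by linarith)).congr ?_
    intro x hx
    rw [uIoc_of_le hpi.le] at hx
    simp only [abs_of_pos hx.1]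
  have h0' : IntervalIntegrable (fun x : ℝ => |x| ^ (ε - 1)) volume (-Real.pi) 0 := by
    have := (IntervalIntegrable.iff_comp_neg (f := fun x : ℝ => |x| ^ (ε - 1))
      (a := 0) (b := Real.pi)).1 h0
    simpa using this.symm
  have h1 := (intervalIntegrable_iff_integrableOn_Ioc_of_le (by linarith)).1 (h0'.trans h0)
  have h2 : Integrable (fun z : Torus => ‖z‖ ^ (ε - 1)) volume := by
    have hm : Measurable (fun z : Torus => ‖z‖ ^ (ε - 1)) := measurable_norm.pow_const _
    rw [← (AddCircle.measurePreserving_mk (2 * Real.pi) (-Real.pi)).integrable_comp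
      hm.aestronglyMeasurable]
    have h3 : (-Real.pi + 2 * Real.pi) = Real.pi := by ring
    rw [h3]
    refine IntegrableOn.congr_fun h1 (fun x hx => ?_) measurableSet_Ioc
    have h4 : ‖(x : Torus)‖ = |x| := by
      rw [AddCircle.norm_coe_eq_abs_iff _ Real.two_pi_pos.ne', abs_of_pos Real.two_pi_pos, abs_le]
      constructor <;> linarith [hx.1, hx.2]
    simp only [Function.comp, h4]
  rw [volume_eq_smul_haarAddCircle, integrable_smul_measure (by simp [hpi])
    ENNReal.ofReal_ne_top] at h2
  exact h2

/-! ### One-sided partial sums of Hölder functions -/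

/-- The constant in the uniform bound for one-sided Fourier partial sums. -/
def partialSumConst (ε : ℝ) : ℝ := ∫ z : Torus, Real.pi * ‖z‖ ^ (ε - 1) ∂haarAddCircle

lemma partialSumConst_nonneg (ε : ℝ) : 0 ≤ partialSumConst ε :=
  integral_nonneg fun z => by have := Real.pi_pos; positivity

/-- The sum of the terms of the Fourier series with indices `1, …, n`. -/
def posPartialSum (n : ℕ) (g : Torus → ℝ) (x : Torus) : ℂ :=
  ∑ j ∈ Finset.range n, fourierCoeff (toComplexFun g) ((j : ℤ) + 1) * fourier ((j : ℤ) + 1) x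

lemma integrable_toComplexFun {g : Torus → ℝ} (hg : Continuous g) :
    Integrable (toComplexFun g) haarAddCircle :=
  (Complex.continuous_ofReal.comp hg).integrable_of_hasCompactSupport
    (HasCompactSupport.of_compactSpace _)

lemma fourierCoeff_const (c : ℂ) {n : ℤ} (hn : n ≠ 0) :
    fourierCoeff (fun _ : Torus => c) n = 0 := by
  have h := fourierCoeff.const_mul (T := 2 * Real.pi) (fun x => fourier 0 x) c n
  simp only [fourier_zero, mul_one] at h
  rw [h]
  have h2 := congrFun (fourierCoeff_fourier (T := 2 * Real.pi) 0) n
  have h3 : (fun x : Torus => (fourier 0 x : ℂ)) = fun _ => 1 := by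
    funext x; exact fourier_zero
  have h4 : fourierCoeff (fun _ : Torus => (1 : ℂ)) n = 0 := by
    rw [← h3]; rw [h2]; simp [hn]
  rw [h4, mul_zero]

/-- Only nonzero frequencies occur, so `g x` may be subtracted from `g` under the integral. The
Hölder bound then turns the kernel singularity `‖x - y‖⁻¹` into the integrable `‖x - y‖^(ε - 1)`. -/
lemma norm_posPartialSum_le {ε A : ℝ} (hε : 0 < ε) (hA : 0 ≤ A) {g : Torus → ℝ}
    (hg : HolderBound ε A g) (n : ℕ) (x : Torus) :
    ‖posPartialSum n g x‖ ≤ partialSumConst ε * A := by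
  have hint := integrable_toComplexFun (hg.continuous hε)
  have hcont : Continuous g := hg.continuous hε
  have h1 : ∀ j : ℕ, fourierCoeff (toComplexFun g) ((j : ℤ) + 1) =
      ∫ y : Torus, fourier (-((j : ℤ) + 1)) y * ((g y : ℂ) - g x) ∂haarAddCircle := fun j => by
    have h2 := fourierCoeff_const (-(g x : ℂ)) (n := (j : ℤ) + 1) (by omega)
    have h3 := congrFun (fourierCoeff.add hint
      (integrable_const (-(g x : ℂ)))) ((j : ℤ) + 1)
    rw [Pi.add_apply, h2, add_zero] at h3
    rw [← h3]
    rfl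
  have h2 : posPartialSum n g x = ∫ y : Torus,
      (∑ j ∈ Finset.range n, (fourier ((j : ℤ) + 1) (x - y) : ℂ)) * ((g y : ℂ) - g x)
        ∂haarAddCircle := by
    simp only [posPartialSum, h1, Finset.sum_mul]
    rw [integral_finsetSum]
    · refine Finset.sum_congr rfl fun j _ => ?_
      rw [← integral_mul_const]
      congr 1
      funext y
      rw [fourier_sub_apply]
      ring
    · intro j _
      refine Continuous.integrable_of_hasCompactSupport ?_ (HasCompactSupport.of_compactSpace _)
      fun_prop
  have hpi := Real.pi_pos
  have hI : Integrable (fun y : Torus => Real.pi * ‖x - y‖ ^ (ε - 1) * A) haarAddCircle :=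
    (((integrable_norm_rpow hε).comp_sub_left x).const_mul Real.pi).mul_const A
  rw [h2]
  refine (norm_integral_le_of_norm_le hI (ae_of_all _ fun y => ?_)).trans (le_of_eq ?_)
  · rw [norm_mul]
    rcases eq_or_ne x y with rfl | hxy
    · simp only [sub_self, norm_zero, mul_zero]
      positivity
    · have hz : 0 < ‖x - y‖ := norm_pos_iff.2 (sub_ne_zero.2 hxy)
      have h3 : ‖(g y : ℂ) - g x‖ ≤ A * ‖x - y‖ ^ ε := by
        rw [← Complex.ofReal_sub, Complex.norm_real, Real.norm_eq_abs, abs_sub_comm, ← dist_eq_norm]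
        exact hg x y
      have h4 : ‖x - y‖ ^ ε = ‖x - y‖ ^ (ε - 1) * ‖x - y‖ := by
        rw [← Real.rpow_add_one hz.ne', sub_add_cancel]
      have h5 := norm_mul_norm_kernel_le n (x - y)
      calc _ ≤ ‖∑ j ∈ Finset.range n, (fourier ((j : ℤ) + 1) (x - y) : ℂ)‖ *
            (A * ‖x - y‖ ^ ε) := by gcongr
        _ = (‖x - y‖ * ‖∑ j ∈ Finset.range n, (fourier ((j : ℤ) + 1) (x - y) : ℂ)‖) *
            (A * ‖x - y‖ ^ (ε - 1)) := by rw [h4]; ring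
        _ ≤ Real.pi * (A * ‖x - y‖ ^ (ε - 1)) := by gcongr
        _ = _ := by ring
  · rw [integral_mul_const, partialSumConst,
      integral_sub_left_eq_self (fun z : Torus => Real.pi * ‖z‖ ^ (ε - 1))]

lemma fourierCoeff_toComplexFun_add {f g : Torus → ℝ} (hf : Continuous f) (hg : Continuous g)
    (n : ℤ) : fourierCoeff (toComplexFun (f + g)) n =
      fourierCoeff (toComplexFun f) n + fourierCoeff (toComplexFun g) n := by
  rw [← Pi.add_apply, ← fourierCoeff.add (integrable_toComplexFun hf) (integrable_toComplexFun hg)]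
  congr 1
  funext x
  simp [toComplexFun]

lemma fourierCoeff_toComplexFun_smul (f : Torus → ℝ) (c : ℝ) (n : ℤ) :
    fourierCoeff (toComplexFun (c • f)) n = c * fourierCoeff (toComplexFun f) n := by
  rw [← fourierCoeff.const_mul]
  congr 1
  funext x
  simp [toComplexFun]

lemma fourierCoeff_toComplexFun_sub {f g : Torus → ℝ} (hf : Continuous f) (hg : Continuous g)
    (n : ℤ) : fourierCoeff (toComplexFun (f - g)) n =
      fourierCoeff (toComplexFun f) n - fourierCoeff (toComplexFun g) n := by
  have h : f - g = f + (-1 : ℝ) • g := by simp [sub_eq_add_neg]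
  rw [h, fourierCoeff_toComplexFun_add hf (hg.const_smul (-1 : ℝ)), fourierCoeff_toComplexFun_smul]
  push_cast
  ring

lemma fourierCoeff_translate (f : Torus → ℂ) (h : Torus) (n : ℤ) :
    fourierCoeff (fun y => f (y + h)) n = fourierCoeff f n * fourier n h := by
  have h1 := integral_add_right_eq_self (μ := haarAddCircle (T := 2 * Real.pi))
    (fun y : Torus => (fourier (-n) (y - h) : ℂ) * f y) h
  simp only [add_sub_cancel_right] at h1
  simp only [fourierCoeff, smul_eq_mul]
  rw [h1, ← integral_mul_const]
  congr 1
  funext y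
  rw [fourier_sub_apply, neg_neg]
  ring

lemma norm_fourierCoeff_le {f : Torus → ℝ} {A : ℝ} (hf : ∀ x, |f x| ≤ A) (n : ℤ) :
    ‖fourierCoeff (toComplexFun f) n‖ ≤ A := by
  have := norm_integral_le_of_norm_le_const (μ := haarAddCircle (T := 2 * Real.pi))
    (f := fun t : Torus => (fourier (-n) t : ℂ) • toComplexFun f t) (C := A)
    (ae_of_all _ fun y => by
      rw [norm_smul, norm_fourier_apply, one_mul, toComplexFun, Complex.norm_real]
      exact hf y)
  simpa [fourierCoeff] using this

lemma posPartialSum_add {f g : Torus → ℝ} (hf : Continuous f) (hg : Continuous g) (n : ℕ)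
    (x : Torus) : posPartialSum n (f + g) x = posPartialSum n f x + posPartialSum n g x := by
  simp only [posPartialSum, fourierCoeff_toComplexFun_add hf hg, add_mul, Finset.sum_add_distrib]

lemma posPartialSum_sub {f g : Torus → ℝ} (hf : Continuous f) (hg : Continuous g) (n : ℕ)
    (x : Torus) : posPartialSum n (f - g) x = posPartialSum n f x - posPartialSum n g x := by
  simp only [posPartialSum, fourierCoeff_toComplexFun_sub hf hg, sub_mul, Finset.sum_sub_distrib]

lemma posPartialSum_translate (g : Torus → ℝ) (n : ℕ) (h x : Torus) :
    posPartialSum n (fun y => g (y + h)) x = posPartialSum n g (x + h) := by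
  refine Finset.sum_congr rfl fun j _ => ?_
  have := fourierCoeff_translate (toComplexFun g) h ((j : ℤ) + 1)
  rw [fourier_add_apply]
  change fourierCoeff (fun y => toComplexFun g (y + h)) _ * _ = _
  rw [this]
  ring

/-- The double difference is controlled both by `‖h‖^γ` and by `dist x y ^ γ`; the smaller of the
two is used and split as a product of powers `γ - ε` and `ε`. -/
lemma _root_.HolderBound.translate_sub {γ ε A : ℝ} (hA : 0 ≤ A) (hε : 0 ≤ ε) (hγ : ε ≤ γ)
    {g : Torus → ℝ} (hg : HolderBound γ A g) (h : Torus) :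
    HolderBound ε (2 * A * ‖h‖ ^ (γ - ε)) ((fun y => g (y + h)) - g) := by
  intro x y
  simp only [Pi.sub_apply]
  have hsplit : ∀ s : ℝ, 0 ≤ s → s ^ (γ - ε) * s ^ ε = s ^ γ := fun s hs => by
    rw [← Real.rpow_add_of_nonneg hs (by linarith) hε, sub_add_cancel]
  rcases le_total ‖h‖ (dist x y) with hle | hle
  · have h1 := hg (x + h) x
    have h2 := hg (y + h) y
    rw [dist_eq_norm, add_sub_cancel_left] at h1 h2
    have h3 : ‖h‖ ^ ε ≤ dist x y ^ ε := by gcongr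
    calc |g (x + h) - g x - (g (y + h) - g y)| ≤ |g (x + h) - g x| + |g (y + h) - g y| :=
          abs_sub _ _
      _ ≤ 2 * A * ‖h‖ ^ γ := by linarith
      _ = 2 * A * ‖h‖ ^ (γ - ε) * ‖h‖ ^ ε := by rw [← hsplit _ (norm_nonneg h)]; ring
      _ ≤ _ := by gcongr
  · have h1 := hg (x + h) (y + h)
    have h2 := hg x y
    rw [dist_add_right] at h1
    have h3 : dist x y ^ (γ - ε) ≤ ‖h‖ ^ (γ - ε) := by
      apply Real.rpow_le_rpow dist_nonneg hle; linarith
    calc |g (x + h) - g x - (g (y + h) - g y)| = |(g (x + h) - g (y + h)) - (g x - g y)| := by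
          congr 1; ring
      _ ≤ |g (x + h) - g (y + h)| + |g x - g y| := abs_sub _ _
      _ ≤ 2 * A * dist x y ^ γ := by linarith
      _ = 2 * A * dist x y ^ (γ - ε) * dist x y ^ ε := by rw [← hsplit _ dist_nonneg]; ring
      _ ≤ _ := by gcongr

/-- Partial sums commute with translations, so the uniform bound at exponent `ε` applies to the
increment `g (· + h) - g`. -/
lemma norm_posPartialSum_add_sub_le {γ ε A : ℝ} (hA : 0 ≤ A) (hε : 0 < ε) (hγ : ε ≤ γ)
    {g : Torus → ℝ} (hg : HolderBound γ A g) (n : ℕ) (x h : Torus) :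
    ‖posPartialSum n g (x + h) - posPartialSum n g x‖ ≤
      2 * partialSumConst ε * A * ‖h‖ ^ (γ - ε) := by
  have hc := hg.continuous (hε.trans_le hγ)
  have h1 := norm_posPartialSum_le hε (by positivity) (hg.translate_sub hA hε.le hγ h) n x
  rw [posPartialSum_sub (by fun_prop) hc, posPartialSum_translate] at h1
  refine h1.trans (le_of_eq (by ring))

/-- Abel summation, used to bound increments of a partial sum at `x` by the earlier partial sums at
the same `x`. -/
lemma sum_mul_pow_sub_one (ω : ℂ) (c : ℕ → ℂ) (n : ℕ) :
    ∑ j ∈ Finset.range n, (ω ^ (j + 1) - 1) * c j =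
      (ω ^ n - 1) * ∑ j ∈ Finset.range n, c j -
        ∑ j ∈ Finset.range n, (ω ^ (j + 1) - ω ^ j) * ∑ i ∈ Finset.range j, c i := by
  induction n with
  | zero => simp
  | succ n ih => simp only [Finset.sum_range_succ] at ih ⊢; rw [ih]; ring

/-- A Bernstein-type estimate: translation by `h` multiplies the `j`-th term by `ω^(j+1)`, and after
Abel summation each of the `n` steps costs `|ω - 1| ≤ ‖h‖`. -/
lemma norm_posPartialSum_add_sub_le_of_bound {M : ℝ} {g : Torus → ℝ} {x : Torus}
    (hM : ∀ m, ‖posPartialSum m g x‖ ≤ M) (n : ℕ) (h : Torus) :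
    ‖posPartialSum n g (x + h) - posPartialSum n g x‖ ≤ 2 * M * (n * ‖h‖) := by
  set ω : ℂ := fourier 1 h with hω
  have hω1 : ‖ω‖ = 1 := norm_fourier_apply 1 h
  have hω2 : ‖ω - 1‖ ≤ ‖h‖ := norm_fourier_one_sub_one_le h
  have hpow : ‖ω ^ n - 1‖ ≤ n * ‖h‖ := by
    rw [← mul_geom_sum, norm_mul, mul_comm]
    refine mul_le_mul ((norm_sum_le _ _).trans ?_) hω2 (norm_nonneg _) (by positivity)
    simp [hω1]
  have h1 : posPartialSum n g (x + h) - posPartialSum n g x =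
      (ω ^ n - 1) * posPartialSum n g x -
        ∑ j ∈ Finset.range n, (ω ^ (j + 1) - ω ^ j) * posPartialSum j g x := by
    simp only [posPartialSum]
    rw [← sum_mul_pow_sub_one, ← Finset.sum_sub_distrib]
    refine Finset.sum_congr rfl fun j _ => ?_
    rw [fourier_add_apply, fourier_natCast_succ j h]
    ring
  have hM0 : 0 ≤ M := (norm_nonneg _).trans (hM 0)
  rw [h1]
  refine (norm_sub_le _ _).trans ?_
  have h2 : ‖(ω ^ n - 1) * posPartialSum n g x‖ ≤ n * ‖h‖ * M := by
    rw [norm_mul]; gcongr; exact hM n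
  have h3 : ‖∑ j ∈ Finset.range n, (ω ^ (j + 1) - ω ^ j) * posPartialSum j g x‖ ≤
      ∑ j ∈ Finset.range n, ‖h‖ * M := by
    refine norm_sum_le_of_le _ fun j _ => ?_
    have : ω ^ (j + 1) - ω ^ j = ω ^ j * (ω - 1) := by ring
    rw [norm_mul, this, norm_mul, norm_pow, hω1, one_pow, one_mul]
    gcongr
    exact hM j
  rw [Finset.sum_const, Finset.card_range, nsmul_eq_mul] at h3
  linarith

/-- Geometric interpolation, with weights `1 - θ` and `θ`, between the uniform `C^(γ - ε)` bound and
the Lipschitz bound of size `n`. -/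
lemma norm_posPartialSum_sub_le {γ ε θ A : ℝ} (hA : 0 ≤ A) (hε : 0 < ε) (hγ : ε ≤ γ)
    (hθ0 : 0 ≤ θ) (hθ1 : θ ≤ 1) {g : Torus → ℝ} (hg : HolderBound γ A g) (n : ℕ) (x y : Torus) :
    ‖posPartialSum n g x - posPartialSum n g y‖ ≤
      2 * (partialSumConst ε + partialSumConst γ) * A * (n : ℝ) ^ θ *
        dist x y ^ ((γ - ε) * (1 - θ) + θ) := by
  have hcε := partialSumConst_nonneg ε
  have hcγ := partialSumConst_nonneg γ
  set D := 2 * (partialSumConst ε + partialSumConst γ) * A with hD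
  have hD0 : 0 ≤ D := by positivity
  set s := dist x y with hs
  have hs0 : 0 ≤ s := dist_nonneg
  have hsn : ‖x - y‖ = s := (dist_eq_norm x y).symm
  set z := ‖posPartialSum n g x - posPartialSum n g y‖ with hz
  have hz0 : 0 ≤ z := norm_nonneg _
  have hzA : z ≤ D * s ^ (γ - ε) := by
    have := norm_posPartialSum_add_sub_le hA hε hγ hg n y (x - y)
    rw [add_sub_cancel, hsn] at this
    refine this.trans ?_
    gcongr
    rw [hD]
    gcongr
    linarith
  have hzB : z ≤ D * (n * s) := by
    have := norm_posPartialSum_add_sub_le_of_bound (x := y)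
      (norm_posPartialSum_le (hε.trans_le hγ) hA hg · y) n (x - y)
    rw [add_sub_cancel, hsn, ← mul_assoc 2] at this
    refine this.trans ?_
    gcongr
    rw [hD]
    gcongr
    linarith
  have hp : 0 ≤ γ - ε := by linarith
  have h1θ : 0 ≤ 1 - θ := by linarith
  calc z = z ^ (1 - θ) * z ^ θ := by
        rw [← Real.rpow_add_of_nonneg hz0 h1θ hθ0, sub_add_cancel, Real.rpow_one]
    _ ≤ (D * s ^ (γ - ε)) ^ (1 - θ) * (D * (n * s)) ^ θ := by gcongr
    _ = (D ^ (1 - θ) * D ^ θ) * (n : ℝ) ^ θ * (s ^ ((γ - ε) * (1 - θ)) * s ^ θ) := by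
        rw [Real.mul_rpow hD0 (by positivity), Real.mul_rpow hD0 (by positivity),
          Real.mul_rpow (by positivity) hs0, ← Real.rpow_mul hs0]
        ring
    _ = _ := by
        rw [← Real.rpow_add_of_nonneg hD0 h1θ hθ0, sub_add_cancel, Real.rpow_one,
          ← Real.rpow_add_of_nonneg hs0 (by positivity) hθ0]

end Torus

/-! ### The symbol and its decrements -/

namespace Torus

/-- The modulus `n / (1 + n ^ β)` of the symbol of `-(1 + |D|^β)⁻¹ ∂_x`. -/
def symbolModulus (β : ℝ) (n : ℕ) : ℝ := n / (1 + (n : ℝ) ^ β)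

/-- The modulus of the symbol of `-(1 + |D|^β)⁻¹ ∂_x P_N`. -/
def truncSymbol (β : ℝ) (N : ℕ∞) (n : ℕ) : ℝ := if (n : ℕ∞) ≤ N then symbolModulus β n else 0

/-- The decrement of `truncSymbol`, the weight of the `n`-th partial sum. -/
def symbolDecrement (β : ℝ) (N : ℕ∞) (n : ℕ) : ℝ := truncSymbol β N n - truncSymbol β N (n + 1)

lemma symbolModulus_nonneg (β : ℝ) (n : ℕ) : 0 ≤ symbolModulus β n := by
  unfold symbolModulus; positivity

lemma symbolModulus_le (β : ℝ) {n : ℕ} (hn : 0 < n) : symbolModulus β n ≤ (n : ℝ) ^ (1 - β) := by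
  have h : (0 : ℝ) < n := by exact_mod_cast hn
  rw [symbolModulus, Real.rpow_sub h, Real.rpow_one]
  have : 0 < (n : ℝ) ^ β := by positivity
  gcongr
  linarith

lemma abs_symbolModulus_sub_le {β : ℝ} (hβ : 1 < β) {n : ℕ} (hn : 0 < n) :
    |symbolModulus β n - symbolModulus β (n + 1)| ≤ β * (n : ℝ) ^ (-β) := by
  have h : (0 : ℝ) < n := by exact_mod_cast hn
  have h1 : (0 : ℝ) < n + 1 := by linarith
  set P := (n : ℝ) ^ β with hP
  set Q := ((n : ℝ) + 1) ^ β with hQ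
  have hP0 : 0 < P := by positivity
  have hPQ : P ≤ Q := by
    rw [hP, hQ]; gcongr; linarith
  -- Bernoulli's inequality for `(1 - 1 / (n + 1))^β` replaces the mean value theorem for `x^β`.
  have hb : (n + 1) * (Q - P) ≤ β * Q := by
    have hb1 := one_add_mul_self_le_rpow_one_add (s := -(1 / ((n : ℝ) + 1))) (p := β)
      (by rw [neg_le_neg_iff, div_le_one h1]; linarith) hβ.le
    have h2 : 1 + -(1 / ((n : ℝ) + 1)) = n / (n + 1) := by field_simp; ring
    rw [h2, Real.div_rpow h.le h1.le, ← hP, ← hQ, le_div_iff₀ (by positivity)] at hb1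
    have h3 : (1 + β * -(1 / ((n : ℝ) + 1))) * Q * (n + 1) = (n + 1) * Q - β * Q := by
      field_simp; ring
    nlinarith
  have hβP : β * (n : ℝ) ^ (-β) = β / P := by rw [Real.rpow_neg h.le]; rfl
  rw [hβP, symbolModulus, symbolModulus]
  push_cast
  rw [← hP, ← hQ]
  have hle : β / (1 + P) ≤ β / P := by gcongr; linarith
  refine le_trans ?_ hle
  have hQ0 : 0 < Q := hP0.trans_le hPQ
  have heq : (n : ℝ) / (1 + P) - (n + 1) / (1 + Q) =
      (n * (Q - P) - (1 + P)) / ((1 + P) * (1 + Q)) := by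
    field_simp; ring
  have heq2 : β / (1 + P) = β * (1 + Q) / ((1 + P) * (1 + Q)) := by field_simp
  rw [heq, heq2, abs_div, abs_of_pos (show 0 < (1 + P) * (1 + Q) by positivity)]
  gcongr
  rw [abs_le]
  constructor <;> nlinarith

/-- Truncation leaves the decrements below `N` unchanged, kills those above, and creates a single
jump at `n = N`. -/
lemma abs_symbolDecrement_le (β : ℝ) (N : ℕ∞) (n : ℕ) :
    |symbolDecrement β N n| ≤ |symbolModulus β n - symbolModulus β (n + 1)| +
      if (n : ℕ∞) = N then symbolModulus β n else 0 := by
  unfold symbolDecrement truncSymbol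
  have h0 := symbolModulus_nonneg β n
  by_cases h1 : (n : ℕ∞) ≤ N
  · by_cases h2 : ((n + 1 : ℕ) : ℕ∞) ≤ N
    · rw [if_pos h1, if_pos h2]
      have : 0 ≤ if (n : ℕ∞) = N then symbolModulus β n else 0 := by split_ifs <;> simp [h0]
      linarith
    · have h3 : (n : ℕ∞) = N := by
        refine le_antisymm h1 ?_
        rw [not_le] at h2
        exact Order.le_of_lt_add_one (by exact_mod_cast h2)
      rw [if_pos h1, if_neg h2, if_pos h3, sub_zero, abs_of_nonneg h0]
      linarith [abs_nonneg (symbolModulus β n - symbolModulus β (n + 1))]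
  · have h2 : ¬ ((n + 1 : ℕ) : ℕ∞) ≤ N := fun h => h1 (le_trans (by exact_mod_cast n.le_succ) h)
    rw [if_neg h1, if_neg h2, sub_zero, abs_zero]
    have : 0 ≤ if (n : ℕ∞) = N then symbolModulus β n else 0 := by split_ifs <;> simp [h0]
    positivity

lemma summable_symbolModulus_sub {β θ : ℝ} (hβ : 1 < β) (hθ0 : 0 < θ) (hθ : θ < β - 1) :
    Summable fun n : ℕ => |symbolModulus β n - symbolModulus β (n + 1)| * (n : ℝ) ^ θ := by
  have h : Summable fun n : ℕ => β * (n : ℝ) ^ (θ - β) :=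
    (Real.summable_nat_rpow.2 (by linarith)).mul_left β
  refine Summable.of_nonneg_of_le (fun n => by positivity) (fun n => ?_) h
  rcases n.eq_zero_or_pos with rfl | hn
  · rw [Nat.cast_zero, Real.zero_rpow hθ0.ne', mul_zero]
    positivity
  · have h' : (0 : ℝ) < n := by exact_mod_cast hn
    calc _ ≤ β * (n : ℝ) ^ (-β) * (n : ℝ) ^ θ := by
          gcongr; exact abs_symbolModulus_sub_le hβ hn
      _ = _ := by rw [mul_assoc, ← Real.rpow_add h']; congr 2; ring

/-- A bound, uniform in `N`, for the weighted sum of the decrements of the symbol. -/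
def decrementConst (β θ : ℝ) : ℝ :=
  (∑' n : ℕ, |symbolModulus β n - symbolModulus β (n + 1)| * (n : ℝ) ^ θ) + 1

lemma decrementConst_nonneg (β θ : ℝ) : 0 ≤ decrementConst β θ :=
  add_nonneg (tsum_nonneg fun n => by positivity) zero_le_one

/-- The jump at `N` contributes at most `N^(1 - β) N^θ ≤ 1` whatever `N ≥ 1` is; this is the `+ 1`
in `decrementConst`. At `n = 0` the weight `0^θ` vanishes. -/
lemma summable_symbolDecrement {β θ : ℝ} (hβ : 1 < β) (hθ0 : 0 < θ) (hθ : θ < β - 1) (N : ℕ∞) :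
    Summable (fun n : ℕ => |symbolDecrement β N n| * (n : ℝ) ^ θ) ∧
      ∑' n : ℕ, |symbolDecrement β N n| * (n : ℝ) ^ θ ≤ decrementConst β θ := by
  have h1 := summable_symbolModulus_sub hβ hθ0 hθ
  have h2 : ∃ s ≤ (1 : ℝ), HasSum (fun n : ℕ => if (n : ℕ∞) = N then (1 : ℝ) else 0) s := by
    induction N with
    | top => exact ⟨0, zero_le_one, by simp [hasSum_zero]⟩
    | coe m =>
      refine ⟨1, le_rfl, ?_⟩
      simpa using hasSum_ite_eq m (1 : ℝ)
  obtain ⟨s, hs1, hs⟩ := h2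
  have hle : ∀ n : ℕ, |symbolDecrement β N n| * (n : ℝ) ^ θ ≤
      |symbolModulus β n - symbolModulus β (n + 1)| * (n : ℝ) ^ θ +
        if (n : ℕ∞) = N then (1 : ℝ) else 0 := fun n => by
    have h3 := mul_le_mul_of_nonneg_right (abs_symbolDecrement_le β N n)
      (show 0 ≤ (n : ℝ) ^ θ by positivity)
    rw [add_mul] at h3
    refine h3.trans (add_le_add le_rfl ?_)
    split_ifs with h
    · rcases n.eq_zero_or_pos with rfl | hn
      · rw [Nat.cast_zero, Real.zero_rpow hθ0.ne', mul_zero]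
        exact zero_le_one
      · have h' : (1 : ℝ) ≤ n := by exact_mod_cast hn
        calc _ ≤ (n : ℝ) ^ (1 - β) * (n : ℝ) ^ θ := by gcongr; exact symbolModulus_le β hn
          _ = (n : ℝ) ^ (1 - β + θ) := by rw [← Real.rpow_add (by linarith)]
          _ ≤ 1 := Real.rpow_le_one_of_one_le_of_nonpos h' (by linarith)
    · simp
  have hs' := h1.add hs.summable
  have hsum := Summable.of_nonneg_of_le (fun n => by positivity) hle hs'
  refine ⟨hsum, (hsum.tsum_le_tsum hle hs').trans ?_⟩
  rw [h1.tsum_add hs.summable, hs.tsum_eq, decrementConst]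
  linarith

lemma tendsto_truncSymbol {β : ℝ} (hβ : 1 < β) (N : ℕ∞) :
    Tendsto (truncSymbol β N) atTop (𝓝 0) := by
  have h : Tendsto (fun n : ℕ => (n : ℝ) ^ (1 - β)) atTop (𝓝 0) := by
    have := (tendsto_rpow_neg_atTop (show 0 < β - 1 by linarith)).comp
      (tendsto_natCast_atTop_atTop (R := ℝ))
    simpa [Function.comp_def] using this
  refine squeeze_zero' (Eventually.of_forall fun n => ?_)
    (eventually_atTop.2 ⟨1, fun n hn => ?_⟩) h
  · unfold truncSymbol
    split_ifs
    · exact symbolModulus_nonneg β n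
    · exact le_rfl
  · unfold truncSymbol
    split_ifs
    · exact symbolModulus_le β hn
    · positivity

/-! ### The smoothing operator: Hölder estimates -/

/-- The operator `-(1 + |D|^β)⁻¹ ∂_x P_N` on real functions, written by summation by parts as a
weighted sum of one-sided Fourier partial sums. -/
def smoothing (β : ℝ) (N : ℕ∞) (g : Torus → ℝ) (x : Torus) : ℝ :=
  ∑' n : ℕ, symbolDecrement β N n * (2 * (posPartialSum n g x).im)

lemma norm_posPartialSum_le_rpow {γ θ A : ℝ} (hγ : 0 < γ) (hA : 0 ≤ A) (hθ0 : 0 ≤ θ)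
    {g : Torus → ℝ} (hg : HolderBound γ A g) (n : ℕ) (x : Torus) :
    ‖posPartialSum n g x‖ ≤ partialSumConst γ * A * (n : ℝ) ^ θ := by
  have hc := partialSumConst_nonneg γ
  rcases n.eq_zero_or_pos with rfl | hn
  · simp only [posPartialSum, Finset.range_zero, Finset.sum_empty, norm_zero]
    positivity
  · refine (norm_posPartialSum_le hγ hA hg n x).trans (le_mul_of_one_le_right (by positivity) ?_)
    exact Real.one_le_rpow (by exact_mod_cast hn) hθ0

lemma abs_smoothing_term_le {β γ θ A : ℝ} (hγ : 0 < γ) (hA : 0 ≤ A) (hθ0 : 0 ≤ θ) (N : ℕ∞)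
    {g : Torus → ℝ} (hg : HolderBound γ A g) (n : ℕ) (x : Torus) :
    |symbolDecrement β N n * (2 * (posPartialSum n g x).im)| ≤
      |symbolDecrement β N n| * (n : ℝ) ^ θ * (2 * partialSumConst γ * A) := by
  rw [abs_mul, abs_mul, abs_two]
  have h1 := (Complex.abs_im_le_norm (posPartialSum n g x)).trans
    (norm_posPartialSum_le_rpow hγ hA hθ0 hg n x)
  calc _ ≤ |symbolDecrement β N n| * (2 * (partialSumConst γ * A * (n : ℝ) ^ θ)) := by gcongr
    _ = _ := by ring

lemma summable_smoothing {β γ θ A : ℝ} (hβ : 1 < β) (hγ : 0 < γ) (hA : 0 ≤ A) (hθ0 : 0 < θ)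
    (hθ : θ < β - 1) (N : ℕ∞)
    {g : Torus → ℝ} (hg : HolderBound γ A g) (x : Torus) :
    Summable fun n : ℕ => symbolDecrement β N n * (2 * (posPartialSum n g x).im) :=
  Summable.of_norm_bounded ((summable_symbolDecrement hβ hθ0 hθ N).1.mul_right
    (2 * partialSumConst γ * A)) (fun n => by
      rw [Real.norm_eq_abs]
      exact abs_smoothing_term_le hγ hA hθ0.le N hg n x)

lemma abs_smoothing_le {β γ θ A : ℝ} (hβ : 1 < β) (hγ : 0 < γ) (hA : 0 ≤ A) (hθ0 : 0 < θ)
    (hθ : θ < β - 1) (N : ℕ∞)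
    {g : Torus → ℝ} (hg : HolderBound γ A g) (x : Torus) :
    |smoothing β N g x| ≤ decrementConst β θ * (2 * partialSumConst γ * A) := by
  have hc := partialSumConst_nonneg γ
  obtain ⟨h1, h2⟩ := summable_symbolDecrement hβ hθ0 hθ N
  rw [← Real.norm_eq_abs, smoothing]
  refine (tsum_of_norm_bounded (h1.hasSum.mul_right (2 * partialSumConst γ * A)) (fun n => by
    rw [Real.norm_eq_abs]
    exact abs_smoothing_term_le hγ hA hθ0.le N hg n x)).trans ?_
  gcongr

/-- The interpolated increment bound is summed against the decrements; its growth `n^θ` is exactly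
the weight in `decrementConst`. -/
lemma holderBound_smoothing {β γ θ A : ℝ} (hβ : 1 < β) (hγ : 0 < γ) (hA : 0 ≤ A) (hθ0 : 0 < θ)
    (hθ : θ < β - 1) (N : ℕ∞)
    {ε : ℝ} (hε : 0 < ε) (hεγ : ε ≤ γ) (hθ1 : θ ≤ 1)
    {g : Torus → ℝ} (hg : HolderBound γ A g) :
    HolderBound ((γ - ε) * (1 - θ) + θ)
      (decrementConst β θ * (4 * (partialSumConst ε + partialSumConst γ) * A))
      (smoothing β N g) := by
  intro x y
  have hcγ := partialSumConst_nonneg γ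
  have hcε := partialSumConst_nonneg ε
  obtain ⟨h1, h2⟩ := summable_symbolDecrement hβ hθ0 hθ N
  have hsx := summable_smoothing hβ hγ hA hθ0 hθ N hg x
  have hsy := summable_smoothing hβ hγ hA hθ0 hθ N hg y
  rw [← Real.norm_eq_abs, smoothing, smoothing, ← hsx.tsum_sub hsy]
  set E := dist x y ^ ((γ - ε) * (1 - θ) + θ) with hE
  have hE0 : 0 ≤ E := by positivity
  refine (tsum_of_norm_bounded (h1.hasSum.mul_right
    (4 * (partialSumConst ε + partialSumConst γ) * A * E)) (fun n => ?_)).trans ?_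
  · have h3 := (Complex.abs_im_le_norm (posPartialSum n g x - posPartialSum n g y)).trans
      (norm_posPartialSum_sub_le hA hε hεγ hθ0.le hθ1 hg n x y)
    rw [← mul_sub, ← mul_sub, ← Complex.sub_im, Real.norm_eq_abs, abs_mul, abs_mul, abs_two]
    calc _ ≤ |symbolDecrement β N n| * (2 * (2 * (partialSumConst ε + partialSumConst γ) * A *
          (n : ℝ) ^ θ * E)) := by gcongr
      _ = _ := by ring
  · rw [mul_assoc (decrementConst β θ)]
    gcongr

lemma smoothing_add {β γ θ A : ℝ} (hβ : 1 < β) (hγ : 0 < γ) (hA : 0 ≤ A) (hθ0 : 0 < θ)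
    (hθ : θ < β - 1) (N : ℕ∞)
    {f g : Torus → ℝ} (hf : HolderBound γ A f) (hg : HolderBound γ A g) :
    smoothing β N (f + g) = smoothing β N f + smoothing β N g := by
  funext x
  rw [Pi.add_apply, smoothing, smoothing, smoothing,
    ← (summable_smoothing hβ hγ hA hθ0 hθ N hf x).tsum_add
      (summable_smoothing hβ hγ hA hθ0 hθ N hg x)]
  congr 1
  funext n
  rw [posPartialSum_add (hf.continuous hγ) (hg.continuous hγ), Complex.add_im]
  ring

/-! ### The smoothing operator: Fourier coefficients -/

lemma continuous_posPartialSum (n : ℕ) (g : Torus → ℝ) : Continuous (posPartialSum n g) := by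
  unfold posPartialSum
  fun_prop

lemma conj_fourierCoeff (g : Torus → ℝ) (n : ℤ) :
    (starRingEnd ℂ) (fourierCoeff (toComplexFun g) n) = fourierCoeff (toComplexFun g) (-n) := by
  rw [fourierCoeff, fourierCoeff, ← integral_conj]
  congr 1
  funext x
  rw [smul_eq_mul, smul_eq_mul, map_mul, ← fourier_neg, toComplexFun, Complex.conj_ofReal]

lemma fourierCoeff_finset_sum_fourier {ι : Type*} (s : Finset ι) (c : ι → ℂ) (m : ι → ℤ) (k : ℤ) :
    fourierCoeff (fun x : Torus => ∑ i ∈ s, c i * fourier (m i) x) k =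
      ∑ i ∈ s, if k = m i then c i else 0 := by
  have h1 : (fun x : Torus => ∑ i ∈ s, c i * (fourier (m i) x : ℂ)) =
      ∑ i ∈ s, fun x : Torus => c i * (fourier (m i) x : ℂ) := by
    funext x; rw [Finset.sum_apply]
  rw [h1, fourierCoeff.sum, Finset.sum_apply]
  · refine Finset.sum_congr rfl fun i _ => ?_
    rw [fourierCoeff.const_mul, fourierCoeff_fourier, Pi.single_apply]
    split_ifs <;> simp
  · intro i _
    refine Continuous.integrable_of_hasCompactSupport ?_ (HasCompactSupport.of_compactSpace _)
    fun_prop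

/-- For real `g` the conjugate of the partial sum carries the frequencies `-n, …, -1`, and `2 Im z =
-i (z - conj z)` produces the factor `-i sign k`. -/
lemma fourierCoeff_two_im_posPartialSum (g : Torus → ℝ) (n : ℕ) (k : ℤ) :
    fourierCoeff (toComplexFun fun x => 2 * (posPartialSum n g x).im) k =
      if k.natAbs ≤ n then -Complex.I * (k.sign : ℂ) * fourierCoeff (toComplexFun g) k else 0 := by
  have h1 : (toComplexFun fun x => 2 * (posPartialSum n g x).im) = fun x : Torus =>
      ∑ p ∈ Finset.range n ×ˢ ({1, -1} : Finset ℤ),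
        (-Complex.I * (p.2 : ℂ) * fourierCoeff (toComplexFun g) (p.2 * ((p.1 : ℤ) + 1))) *
          fourier (p.2 * ((p.1 : ℤ) + 1)) x := by
    funext x
    have h2 : ∀ z : ℂ, ((2 * z.im : ℝ) : ℂ) = -Complex.I * (z - (starRingEnd ℂ) z) := fun z => by
      rw [Complex.sub_conj]
      push_cast
      linear_combination (2 * (z.im : ℂ)) * Complex.I_mul_I
    rw [toComplexFun, h2, posPartialSum, map_sum, ← Finset.sum_sub_distrib, Finset.mul_sum,
      Finset.sum_product]
    refine Finset.sum_congr rfl fun j _ => ?_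
    rw [Finset.sum_pair (by norm_num), map_mul, conj_fourierCoeff, ← fourier_neg]
    simp only [one_mul, neg_one_mul, Int.cast_one, Int.cast_neg]
    ring
  rw [h1, fourierCoeff_finset_sum_fourier, Finset.sum_product]
  simp only [Finset.sum_pair (show (1 : ℤ) ≠ -1 by norm_num), one_mul, neg_one_mul, Int.cast_one,
    Int.cast_neg, mul_one]
  rcases lt_trichotomy k 0 with hk | rfl | hk
  · obtain ⟨m, rfl⟩ : ∃ m : ℕ, k = -((m : ℤ) + 1) := ⟨(-k - 1).toNat, by omega⟩
    have h3 : ∀ j : ℕ, ¬ (-((m : ℤ) + 1) = (j : ℤ) + 1) := fun j => by omega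
    have h4 : ∀ j : ℕ, (-((m : ℤ) + 1) = -((j : ℤ) + 1)) ↔ m = j := fun j => by omega
    have h5 : (-((m : ℤ) + 1)).natAbs ≤ n ↔ m < n := by omega
    have h6 : (-((m : ℤ) + 1)).sign = -1 := Int.sign_eq_neg_one_of_neg hk
    simp only [h3, h4, h5, h6, if_false, zero_add, Finset.sum_ite_eq, Finset.mem_range]
    push_cast
    simp
  · simp only [Int.sign_zero, Int.cast_zero, mul_zero, zero_mul, ite_self]
    refine Finset.sum_eq_zero fun j _ => ?_
    rw [if_neg (by omega), if_neg (by omega), add_zero]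
  · obtain ⟨m, rfl⟩ : ∃ m : ℕ, k = (m : ℤ) + 1 := ⟨(k - 1).toNat, by omega⟩
    have h3 : ∀ j : ℕ, ¬ ((m : ℤ) + 1 = -((j : ℤ) + 1)) := fun j => by omega
    have h4 : ∀ j : ℕ, ((m : ℤ) + 1 = (j : ℤ) + 1) ↔ m = j := fun j => by omega
    have h5 : ((m : ℤ) + 1).natAbs ≤ n ↔ m < n := by omega
    have h6 : ((m : ℤ) + 1).sign = 1 := Int.sign_eq_one_of_pos hk
    simp only [h3, h4, h5, h6, if_false, add_zero, Finset.sum_ite_eq, Finset.mem_range]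
    push_cast
    simp

lemma sum_range_ite_symbolDecrement (β : ℝ) (N : ℕ∞) (K m : ℕ) (hm : K ≤ m) :
    ∑ n ∈ Finset.range m, (if K ≤ n then symbolDecrement β N n else 0) =
      truncSymbol β N K - truncSymbol β N m := by
  induction m, hm using Nat.le_induction with
  | base =>
    rw [sub_self]
    refine Finset.sum_eq_zero fun n hn => if_neg ?_
    rw [Finset.mem_range] at hn
    omega
  | succ m hm ih =>
    rw [Finset.sum_range_succ, ih, if_pos hm, symbolDecrement]
    ring

/-- Absolute convergence lets the coefficient be taken term by term. Only the terms `n ≥ |k|` see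
the frequency `k`; their decrements telescope to the symbol at `|k|`, since the symbol tends to
zero. -/
lemma fourierCoeff_smoothing {β γ θ A : ℝ} (hβ : 1 < β) (hγ : 0 < γ) (hA : 0 ≤ A) (hθ0 : 0 < θ)
    (hθ : θ < β - 1) (N : ℕ∞) {g : Torus → ℝ} (hg : HolderBound γ A g) (k : ℤ) :
    fourierCoeff (toComplexFun (smoothing β N g)) k =
      truncSymbol β N k.natAbs *
        (-Complex.I * (k.sign : ℂ) * fourierCoeff (toComplexFun g) k) := by
  set z : ℂ := -Complex.I * (k.sign : ℂ) * fourierCoeff (toComplexFun g) k with hz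
  let F : ℕ → Torus → ℂ := fun n y => fourier (-k) y •
    toComplexFun (fun x => symbolDecrement β N n * (2 * (posPartialSum n g x).im)) y
  have hFc : ∀ n, Continuous (F n) := fun n => by
    have := continuous_posPartialSum n g
    have h2 : Continuous (toComplexFun
        (fun x => symbolDecrement β N n * (2 * (posPartialSum n g x).im))) := by
      unfold toComplexFun
      fun_prop
    fun_prop
  have hFi : ∀ n, Integrable (F n) haarAddCircle := fun n =>
    (hFc n).integrable_of_hasCompactSupport (HasCompactSupport.of_compactSpace _)
  have hFn : ∀ n y, ‖F n y‖ ≤ |symbolDecrement β N n| * (n : ℝ) ^ θ *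
      (2 * partialSumConst γ * A) := fun n y => by
    rw [norm_smul, norm_fourier_apply, one_mul, toComplexFun, Complex.norm_real]
    exact abs_smoothing_term_le hγ hA hθ0.le N hg n y
  have hsum : Summable fun n => ∫ y, ‖F n y‖ ∂haarAddCircle := by
    refine Summable.of_nonneg_of_le (fun n => integral_nonneg fun y => norm_nonneg _)
      (fun n => ?_) ((summable_symbolDecrement hβ hθ0 hθ N).1.mul_right
        (2 * partialSumConst γ * A))
    have := integral_mono (hFi n).norm (integrable_const _) (hFn n)
    simpa using this
  have h1 := (hasSum_integral_of_summable_integral_norm hFi hsum).tendsto_sum_nat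
  have h2 : ∀ n, ∫ y, F n y ∂haarAddCircle =
      ((if k.natAbs ≤ n then symbolDecrement β N n else 0 : ℝ) : ℂ) * z := fun n => by
    change fourierCoeff (toComplexFun (symbolDecrement β N n • fun x =>
      (2 * (posPartialSum n g x).im))) k = _
    rw [fourierCoeff_toComplexFun_smul, fourierCoeff_two_im_posPartialSum]
    split_ifs <;> simp [hz]
  have h3 : ∫ y, ∑' n, F n y ∂haarAddCircle = fourierCoeff (toComplexFun (smoothing β N g)) k := by
    rw [fourierCoeff]
    congr 1
    funext y
    rw [toComplexFun, smoothing, Complex.ofReal_tsum, smul_eq_mul, ← tsum_mul_left]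
    rfl
  rw [h3] at h1
  refine tendsto_nhds_unique h1 ?_
  have h4 : Tendsto (fun m => ((truncSymbol β N k.natAbs - truncSymbol β N m : ℝ) : ℂ) * z) atTop
      (𝓝 (((truncSymbol β N k.natAbs - 0 : ℝ) : ℂ) * z)) :=
    ((Complex.continuous_ofReal.tendsto _).comp
      (tendsto_const_nhds.sub (tendsto_truncSymbol hβ N))).mul_const z
  rw [sub_zero] at h4
  refine h4.congr' (eventually_atTop.2 ⟨k.natAbs, fun m hm => ?_⟩)
  simp only [h2]
  rw [← Finset.sum_mul, ← Complex.ofReal_sum, sum_range_ite_symbolDecrement β N _ _ hm]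

lemma one_add_rpow_mul_fourierCoeff_smoothing {β γ θ A : ℝ} (hβ : 1 < β) (hγ : 0 < γ)
    (hA : 0 ≤ A) (hθ0 : 0 < θ) (hθ : θ < β - 1) (N : ℕ∞) {g : Torus → ℝ}
    (hg : HolderBound γ A g) (k : ℤ) :
    (1 + ((|(k : ℝ)| ^ β : ℝ) : ℂ)) * fourierCoeff (toComplexFun (smoothing β N g)) k =
      if (k.natAbs : ℕ∞) ≤ N then -Complex.I * k * fourierCoeff (toComplexFun g) k else 0 := by
  rw [fourierCoeff_smoothing hβ hγ hA hθ0 hθ N hg, truncSymbol]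
  split_ifs
  · rw [symbolModulus, Nat.cast_natAbs, Int.cast_abs]
    have h0 : 0 < 1 + |(k : ℝ)| ^ β := by positivity
    have h1 : (1 + ((|(k : ℝ)| ^ β : ℝ) : ℂ)) ≠ 0 := by exact_mod_cast h0.ne'
    have h2 : ((|(k : ℝ)| : ℝ) : ℂ) * (k.sign : ℂ) = k := by
      have : |k| * k.sign = k := by rw [mul_comm]; exact Int.sign_mul_abs k
      exact_mod_cast this
    rw [Complex.ofReal_div, Complex.ofReal_add, Complex.ofReal_one]
    field_simp
    linear_combination (-fourierCoeff (toComplexFun g) k) * h2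
  · simp

end Torus

/-! ### Products, change of exponent and the projection `P_N` -/

lemma HolderBound.mono {γ A B : ℝ} (hAB : A ≤ B) {f : Torus → ℝ} (hf : HolderBound γ A f) :
    HolderBound γ B f := fun x y =>
  (hf x y).trans (mul_le_mul_of_nonneg_right hAB (by positivity))

lemma HolderBound.of_exponent_le {α γ A : ℝ} (hA : 0 ≤ A) (hγ : 0 ≤ γ) (hγα : γ ≤ α)
    {f : Torus → ℝ} (hf : HolderBound α A f) : HolderBound γ (Real.pi ^ (α - γ) * A) f := by
  intro x y
  have hd : dist x y ≤ Real.pi := by rw [dist_eq_norm]; exact Torus.norm_le_pi _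
  have h1 : dist x y ^ α = dist x y ^ (α - γ) * dist x y ^ γ := by
    rw [← Real.rpow_add_of_nonneg dist_nonneg (by linarith) hγ, sub_add_cancel]
  have h2 : dist x y ^ (α - γ) ≤ Real.pi ^ (α - γ) :=
    Real.rpow_le_rpow dist_nonneg hd (by linarith)
  calc _ ≤ A * dist x y ^ α := hf x y
    _ = dist x y ^ (α - γ) * (A * dist x y ^ γ) := by rw [h1]; ring
    _ ≤ Real.pi ^ (α - γ) * (A * dist x y ^ γ) := by gcongr
    _ = _ := by ring

lemma HolderBound.mul {γ A B a b : ℝ} (hA : 0 ≤ A) {f g : Torus → ℝ}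
    (hf : HolderBound γ A f) (hg : HolderBound γ B g) (hfa : ∀ x, |f x| ≤ a)
    (hgb : ∀ x, |g x| ≤ b) : HolderBound γ (a * B + b * A) (f * g) := by
  intro x y
  have h1 := hf x y
  have h2 := hg x y
  have h3 : 0 ≤ B * dist x y ^ γ := (abs_nonneg _).trans h2
  calc |(f * g) x - (f * g) y| = |f x * (g x - g y) + (f x - f y) * g y| := by
        congr 1; simp only [Pi.mul_apply]; ring
    _ ≤ |f x| * |g x - g y| + |f x - f y| * |g y| := by
        rw [← abs_mul, ← abs_mul]; exact abs_add_le _ _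
    _ ≤ a * (B * dist x y ^ γ) + (A * dist x y ^ γ) * b := by
        have := (abs_nonneg _).trans (hfa x)
        gcongr
        · exact hfa x
        · exact hgb y
    _ = _ := by ring

namespace Torus

/-- The projection `P_N` on real functions. -/
def realProj : ℕ∞ → (Torus → ℝ) → Torus → ℝ
  | none, g => g
  | some N, g => fun x => (fourierCoeff (toComplexFun g) 0).re + 2 * (posPartialSum N g x).re

lemma sum_Icc_neg_eq (N : ℕ) (c : ℤ → ℂ) :
    ∑ n ∈ Finset.Icc (-(N : ℤ)) N, c n =
      c 0 + ∑ j ∈ Finset.range N, (c ((j : ℤ) + 1) + c (-((j : ℤ) + 1))) := by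
  induction N with
  | zero => simp
  | succ N ih =>
    have h : Finset.Icc (-((N + 1 : ℕ) : ℤ)) ((N + 1 : ℕ) : ℤ) =
        insert ((N : ℤ) + 1) (insert (-((N : ℤ) + 1)) (Finset.Icc (-(N : ℤ)) N)) := by
      ext m
      simp only [Finset.mem_Icc, Finset.mem_insert]
      omega
    rw [h, Finset.sum_insert, Finset.sum_insert, ih, Finset.sum_range_succ]
    · ring
    · simp only [Finset.mem_Icc]; omega
    · simp only [Finset.mem_Icc, Finset.mem_insert]; omega

lemma freqProj_toComplexFun (N : ℕ∞) (g : Torus → ℝ) :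
    freqProj N (toComplexFun g) = toComplexFun (realProj N g) := by
  match N with
  | none => rfl
  | some N =>
    funext x
    have h0 : ((fourierCoeff (toComplexFun g) 0).re : ℂ) = fourierCoeff (toComplexFun g) 0 := by
      rw [← Complex.conj_eq_iff_re, conj_fourierCoeff, neg_zero]
    have h2 : ∀ z : ℂ, ((2 * z.re : ℝ) : ℂ) = z + (starRingEnd ℂ) z := fun z => by
      rw [Complex.add_conj]
    simp only [freqProj, toComplexFun, realProj]
    rw [Complex.ofReal_add, h2]
    change _ = ((fourierCoeff (toComplexFun g) 0).re : ℂ) + _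
    rw [h0]
    rw [sum_Icc_neg_eq, posPartialSum, map_sum, ← Finset.sum_add_distrib, fourier_zero, mul_one]
    congr 1
    refine Finset.sum_congr rfl fun j _ => ?_
    rw [map_mul, conj_fourierCoeff, ← fourier_neg]

lemma fourierCoeff_freqProj (N : ℕ∞) (f : Torus → ℂ) (k : ℤ) :
    fourierCoeff (freqProj N f) k =
      if (k.natAbs : ℕ∞) ≤ N then fourierCoeff f k else 0 := by
  match N with
  | none => exact (if_pos le_top).symm
  | some N =>
    have h : ((k.natAbs : ℕ∞) ≤ some N) ↔ k ∈ Finset.Icc (-(N : ℤ)) N := by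
      change ((k.natAbs : ℕ∞) ≤ (N : ℕ∞)) ↔ _
      rw [Nat.cast_le, Finset.mem_Icc]
      omega
    simp only [h]
    change fourierCoeff (fun x => ∑ n ∈ Finset.Icc (-(N : ℤ)) N,
      fourierCoeff f n * fourier n x) k = _
    rw [fourierCoeff_finset_sum_fourier, Finset.sum_ite_eq]

lemma truncatedSquare_eq (N : ℕ∞) (g : Torus → ℝ) :
    truncatedSquare N g = freqProj N (toComplexFun (realProj N g * realProj N g)) := by
  rw [truncatedSquare, freqProj_toComplexFun]
  congr 1
  funext x
  simp [toComplexFun, sq]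

lemma realProj_add {f g : Torus → ℝ} (hf : Continuous f) (hg : Continuous g) (N : ℕ∞) :
    realProj N (f + g) = realProj N f + realProj N g := by
  match N with
  | none => rfl
  | some N =>
    funext x
    simp only [realProj, Pi.add_apply, posPartialSum_add hf hg,
      fourierCoeff_toComplexFun_add hf hg, Complex.add_re]
    ring

lemma realProj_sub {f g : Torus → ℝ} (hf : Continuous f) (hg : Continuous g) (N : ℕ∞) :
    realProj N (f - g) = realProj N f - realProj N g := by
  have h := realProj_add (hf.sub hg) hg N
  rw [sub_add_cancel] at h
  rw [h, add_sub_cancel_right]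

/-- The constant in the bound of `P_N` from `C^α` to `C^(α - ε)`. -/
def projConst (α ε : ℝ) : ℝ :=
  1 + 4 * (partialSumConst ε + partialSumConst α) + Real.pi ^ ε

lemma projConst_nonneg (α ε : ℝ) : 0 ≤ projConst α ε := by
  have h1 := partialSumConst_nonneg ε
  have h2 := partialSumConst_nonneg α
  have := Real.pi_pos
  unfold projConst
  positivity

/-- For finite `N` this is the case `θ = 0` of the increment estimate, where the constant does not
depend on `N`; for `N = ∞` the loss of `ε` is paid by the diameter `π` of the torus. -/
lemma realProj_bounds {α ε A : ℝ} (hε : 0 < ε) (hεα : ε ≤ α) (hA : 0 ≤ A) {f : Torus → ℝ}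
    (hfA : ∀ x, |f x| ≤ A) (hf : HolderBound α A f) (N : ℕ∞) :
    (∀ x, |realProj N f x| ≤ projConst α ε * A) ∧
      HolderBound (α - ε) (projConst α ε * A) (realProj N f) := by
  have h1 := partialSumConst_nonneg ε
  have h2 := partialSumConst_nonneg α
  have h3 : 0 < Real.pi ^ ε := Real.rpow_pos_of_pos Real.pi_pos _
  match N with
  | none =>
    refine ⟨fun x => (hfA x).trans (le_mul_of_one_le_left hA (by unfold projConst; linarith)), ?_⟩
    have h := hf.of_exponent_le hA (γ := α - ε) (by linarith) (by linarith)
    rw [sub_sub_cancel] at h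
    refine h.mono (mul_le_mul_of_nonneg_right ?_ hA)
    unfold projConst; linarith
  | some N =>
    constructor
    · intro x
      have h4 := (Complex.abs_re_le_norm _).trans (norm_fourierCoeff_le hfA 0)
      have h5 := (Complex.abs_re_le_norm _).trans
        (norm_posPartialSum_le (hε.trans_le hεα) hA hf N x)
      calc |realProj (some N) f x| ≤ |(fourierCoeff (toComplexFun f) 0).re| +
            |2 * (posPartialSum N f x).re| := abs_add_le _ _
        _ ≤ A + 2 * (partialSumConst α * A) := by rw [abs_mul, abs_two]; gcongr
        _ = (1 + 2 * partialSumConst α) * A := by ring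
        _ ≤ _ := mul_le_mul_of_nonneg_right (by unfold projConst; linarith) hA
    · intro x y
      have h4 := (Complex.abs_re_le_norm _).trans
        (norm_posPartialSum_sub_le hA hε hεα le_rfl zero_le_one hf N x y)
      rw [Real.rpow_zero, mul_one, sub_zero, mul_one, add_zero] at h4
      calc |realProj (some N) f x - realProj (some N) f y| =
            |2 * (posPartialSum N f x - posPartialSum N f y).re| := by
            congr 1; simp only [realProj, Complex.sub_re]; ring
        _ ≤ 2 * (2 * (partialSumConst ε + partialSumConst α) * A * dist x y ^ (α - ε)) := by
            rw [abs_mul, abs_two]; gcongr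
        _ = 4 * (partialSumConst ε + partialSumConst α) * A * dist x y ^ (α - ε) := by ring
        _ ≤ _ := by gcongr; unfold projConst; linarith

/-! ### The vector field on `C^α` -/

/-- The expression `-(1 + |D|^β)⁻¹ ∂_x (f + P_N (P_N g * P_N h))`. -/
def smoothingForm (β : ℝ) (N : ℕ∞) (f g h : Torus → ℝ) : Torus → ℝ :=
  smoothing β ⊤ f + smoothing β N (realProj N g * realProj N h)

/-- `P_N` loses `ε`, the partial sums lose another `ε`, and interpolation must restore `α`. This
forces `θ = 2 ε / (1 - α + 2 ε)`, which tends to zero with `ε`, so that `θ < β - 1` holds for small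
`ε`. -/
lemma exists_exponents {α β : ℝ} (hα₀ : 0 < α) (hα₁ : α < 1) (hβ : 1 < β) :
    ∃ ε θ : ℝ, 0 < ε ∧ ε ≤ α - ε ∧ 0 < θ ∧ θ ≤ 1 ∧ θ < β - 1 ∧
      (α - ε - ε) * (1 - θ) + θ = α := by
  set ε := min (α / 4) ((β - 1) * (1 - α) / 4) with hε
  have h1 : ε ≤ α / 4 := min_le_left _ _
  have h2 : ε ≤ (β - 1) * (1 - α) / 4 := min_le_right _ _
  have h0 : 0 < ε := lt_min (by linarith)
    (div_pos (mul_pos (by linarith) (by linarith)) (by norm_num))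
  have hd : 0 < 1 - α + 2 * ε := by linarith
  refine ⟨ε, 2 * ε / (1 - α + 2 * ε), h0, by linarith, by positivity, ?_, ?_, ?_⟩
  · rw [div_le_one hd]; linarith
  · rw [div_lt_iff₀ hd]; nlinarith
  · have h3 : 2 * ε / (1 - α + 2 * ε) * (1 - α + 2 * ε) = 2 * ε := div_mul_cancel₀ _ hd.ne'
    linear_combination h3

/-- Three independent arguments allow one estimate to give both the growth of the vector field and,
by polarization, its Lipschitz bound. -/
lemma smoothingForm_bounds {α β : ℝ} (hα₀ : 0 < α) (hα₁ : α < 1) (hβ : 1 < β) :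
    ∃ C : ℝ, 0 < C ∧ ∀ (N : ℕ∞) (f g h : HolderFun α),
      (∀ x, |smoothingForm β N f g h x| ≤ C * (‖f‖ + ‖g‖ * ‖h‖)) ∧
        HolderBound α (C * (‖f‖ + ‖g‖ * ‖h‖)) (smoothingForm β N f g h) := by
  obtain ⟨ε, θ, hε, hεγ, hθ0, hθ1, hθ, heq⟩ := exists_exponents hα₀ hα₁ hβ
  have hγ : 0 < α - ε := hε.trans_le hεγ
  have hW := decrementConst_nonneg β θ
  have hcε := partialSumConst_nonneg ε
  have hcγ := partialSumConst_nonneg (α - ε)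
  have hP := projConst_nonneg α ε
  set D := decrementConst β θ * (4 * (partialSumConst ε + partialSumConst (α - ε))) with hD
  have hD0 : 0 ≤ D := by positivity
  have hpi : 0 ≤ Real.pi ^ ε := Real.rpow_nonneg Real.pi_pos.le _
  set Q := Real.pi ^ ε + 2 * projConst α ε ^ 2 with hQ
  have hQ0 : 0 ≤ Q := by positivity
  have key : ∀ (N : ℕ∞) (A : ℝ) (g : Torus → ℝ), 0 ≤ A → HolderBound (α - ε) A g →
      (∀ x, |smoothing β N g x| ≤ D * A) ∧ HolderBound α (D * A) (smoothing β N g) := by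
    intro N A g hA hg
    refine ⟨fun x => (abs_smoothing_le hβ hγ hA hθ0 hθ N hg x).trans ?_, ?_⟩
    · rw [hD, mul_assoc (decrementConst β θ)]
      refine mul_le_mul_of_nonneg_left (mul_le_mul_of_nonneg_right ?_ hA) hW
      linarith
    · have := holderBound_smoothing hβ hγ hA hθ0 hθ N hε hεγ hθ1 hg
      rwa [heq, ← mul_assoc, ← hD] at this
  refine ⟨D * Q + 1, by positivity, fun N f g h => ?_⟩
  have hf : HolderBound (α - ε) (Real.pi ^ ε * ‖f‖) f := by
    have := f.holderBound.of_exponent_le (norm_nonneg _) hγ.le (by linarith : α - ε ≤ α)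
    rwa [sub_sub_cancel] at this
  obtain ⟨g1, g2⟩ := realProj_bounds hε (by linarith) (norm_nonneg g) g.abs_apply_le
    g.holderBound N
  obtain ⟨h1, h2⟩ := realProj_bounds hε (by linarith) (norm_nonneg h) h.abs_apply_le
    h.holderBound N
  have hgh := g2.mul (by positivity) h2 g1 h1
  obtain ⟨a1, a2⟩ := key ⊤ _ _ (by positivity) hf
  obtain ⟨b1, b2⟩ := key N _ _ (by positivity) hgh
  have hle : D * (Real.pi ^ ε * ‖f‖) + D * (projConst α ε * ‖g‖ * (projConst α ε * ‖h‖) +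
      projConst α ε * ‖h‖ * (projConst α ε * ‖g‖)) ≤ (D * Q + 1) * (‖f‖ + ‖g‖ * ‖h‖) := by
    have hf0 := norm_nonneg f
    have hgh0 : 0 ≤ ‖g‖ * ‖h‖ := by positivity
    have e1 : Real.pi ^ ε * ‖f‖ + 2 * projConst α ε ^ 2 * (‖g‖ * ‖h‖) ≤
        Q * (‖f‖ + ‖g‖ * ‖h‖) := by
      have : 0 ≤ 2 * projConst α ε ^ 2 * ‖f‖ + Real.pi ^ ε * (‖g‖ * ‖h‖) := by positivity
      rw [hQ]; linarith
    have e2 := mul_le_mul_of_nonneg_left e1 hD0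
    linarith
  exact ⟨fun x => (abs_add_le _ _).trans ((add_le_add (a1 x) (b1 x)).trans hle),
    (a2.add b2).mono hle⟩

lemma smoothing_add_of_holderBound {β γ A B : ℝ} (hβ : 1 < β) (hγ : 0 < γ) (N : ℕ∞)
    (hA : 0 ≤ A) {f g : Torus → ℝ} (hf : HolderBound γ A f) (hg : HolderBound γ B g) :
    smoothing β N (f + g) = smoothing β N f + smoothing β N g :=
  smoothing_add (θ := (β - 1) / 2) hβ hγ (hA.trans (le_max_left A B)) (by linarith)
    (by linarith) N (hf.mono (le_max_left _ _)) (hg.mono (le_max_right _ _))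

lemma continuous_smoothing {β γ A : ℝ} (hβ : 1 < β) (hγ : 0 < γ) (hA : 0 ≤ A) (N : ℕ∞)
    {g : Torus → ℝ} (hg : HolderBound γ A g) : Continuous (smoothing β N g) := by
  have hθ0 : 0 < min 1 ((β - 1) / 2) := lt_min one_pos (by linarith)
  have hθ1 : min 1 ((β - 1) / 2) ≤ 1 := min_le_left _ _
  have hθ : min 1 ((β - 1) / 2) < β - 1 := (min_le_right _ _).trans_lt (by linarith)
  refine (holderBound_smoothing hβ hγ hA hθ0 hθ N hγ le_rfl hθ1 hg).continuous ?_
  rw [sub_self, zero_mul, zero_add]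
  exact hθ0

/-- This is `u² - v² = (u - v)(u + v)`. The Hölder bounds are needed because `smoothing` is an
infinite sum, additive only where it converges. -/
lemma smoothingForm_sub {α β : ℝ} (hα₀ : 0 < α) (hα₁ : α < 1) (hβ : 1 < β) (N : ℕ∞)
    (u v : HolderFun α) :
    smoothingForm β N u u u - smoothingForm β N v v v =
      smoothingForm β N (u - v : HolderFun α) (u - v : HolderFun α) (u + v : HolderFun α) := by
  obtain ⟨ε, θ, hε, hεγ, -⟩ := exists_exponents hα₀ hα₁ hβ
  have hγ : 0 < α - ε := hε.trans_le hεγ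
  have hP := projConst_nonneg α ε
  have hu := u.continuous_coe hα₀
  have hv := v.continuous_coe hα₀
  have h1 : smoothing β ⊤ u = smoothing β ⊤ v + smoothing β ⊤ (u - v : HolderFun α) := by
    rw [← smoothing_add_of_holderBound hβ hα₀ ⊤ (norm_nonneg _) v.holderBound
      (u - v).holderBound, HolderFun.coe_sub, add_sub_cancel]
  have hb := fun w : HolderFun α => realProj_bounds hε (by linarith) (norm_nonneg w)
    w.abs_apply_le w.holderBound N
  have h2 : smoothing β N (realProj N u * realProj N u) =
      smoothing β N (realProj N v * realProj N v) + smoothing β N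
        (realProj N (u - v : HolderFun α) * realProj N (u + v : HolderFun α)) := by
    rw [← smoothing_add_of_holderBound hβ hγ N (by positivity)
      ((hb v).2.mul (by positivity) (hb v).2 (hb v).1 (hb v).1)
      ((hb (u - v)).2.mul (by positivity) (hb (u + v)).2 (hb (u - v)).1
        (hb (u + v)).1), HolderFun.coe_sub, HolderFun.coe_add, realProj_sub hu hv,
      realProj_add hu hv]
    congr 1
    ring
  unfold smoothingForm
  rw [h1, h2]
  ring

/-- The equation `∂_t u = F(u)` in `C^α`, with `F(u) = -(1 + |D|^β)⁻¹ ∂_x (u + P_N (P_N u)²)`. -/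
lemma exists_vectorField {α β : ℝ} (hα₀ : 0 < α) (hα₁ : α < 1) (hβ : 1 < β) :
    ∃ C : ℝ, 0 < C ∧ ∀ N : ℕ∞, ∃ F : HolderFun α → HolderFun α,
      (∀ u, ‖F u‖ ≤ C * (‖u‖ + ‖u‖ ^ 2)) ∧
      (∀ u v, ‖F u - F v‖ ≤ C * (1 + ‖u‖ + ‖v‖) * ‖u - v‖) ∧
      ∀ u (k : ℤ), fourierCoeff (toComplexFun (F u)) k +
        ((|(k : ℝ)| ^ β : ℝ) : ℂ) * fourierCoeff (toComplexFun (F u)) k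
        + Complex.I * k * fourierCoeff (toComplexFun u) k
        + Complex.I * k * fourierCoeff (truncatedSquare N u) k = 0 := by
  obtain ⟨C, hC, h⟩ := smoothingForm_bounds hα₀ hα₁ hβ
  -- The factor `2` adds the supremum and the Hölder seminorm, each bounded with constant `C`.
  refine ⟨2 * C, by positivity, fun N => ?_⟩
  have hmem : ∀ u : HolderFun α, smoothingForm β N u u u ∈ holderSpace α := fun u =>
    mem_holderSpace_of_bounds (by positivity) (by positivity) (h N u u u).1 (h N u u u).2
  refine ⟨fun u => HolderFun.of _ (hmem u), fun u => ?_, fun u v => ?_, fun u k => ?_⟩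
  · have := HolderFun.norm_le (f := HolderFun.of _ (hmem u)) (by positivity) (by positivity)
      (h N u u u).1 (h N u u u).2
    refine this.trans (le_of_eq (by ring))
  · obtain ⟨h1, h2⟩ := h N (u - v) (u - v) (u + v)
    rw [← smoothingForm_sub hα₀ hα₁ hβ] at h1 h2
    have h3 := HolderFun.norm_le (f := HolderFun.of _ (hmem u) - HolderFun.of _ (hmem v))
      (by positivity) (by positivity) h1 h2
    refine h3.trans ?_
    have h4 := norm_add_le u v
    have h5 := norm_nonneg (u - v)
    calc _ = 2 * C * (1 + ‖u + v‖) * ‖u - v‖ := by ring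
      _ ≤ 2 * C * (1 + ‖u‖ + ‖v‖) * ‖u - v‖ := by
        rw [add_assoc 1]; gcongr
  · obtain ⟨ε, θ, hε, hεγ, hθ0, -, hθ, -⟩ := exists_exponents hα₀ hα₁ hβ
    have hγ : 0 < α - ε := hε.trans_le hεγ
    have hP := projConst_nonneg α ε
    obtain ⟨g1, g2⟩ := realProj_bounds hε (by linarith) (norm_nonneg u) u.abs_apply_le
      u.holderBound N
    have hgg := g2.mul (by positivity) g2 g1 g1
    have e1 := one_add_rpow_mul_fourierCoeff_smoothing hβ hα₀ (norm_nonneg u) hθ0 hθ ⊤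
      u.holderBound k
    have e2 := one_add_rpow_mul_fourierCoeff_smoothing hβ hγ (by positivity) hθ0 hθ N hgg k
    rw [if_pos le_top] at e1
    have e3 : fourierCoeff (toComplexFun (smoothingForm β N u u u)) k = _ :=
      fourierCoeff_toComplexFun_add (continuous_smoothing hβ hα₀ (norm_nonneg _) ⊤
          u.holderBound) (continuous_smoothing hβ hγ (by positivity) N hgg) k
    rw [truncatedSquare_eq, fourierCoeff_freqProj, HolderFun.coe_of, e3]
    split_ifs at e2 ⊢ <;> linear_combination e1 + e2

end Torus

/-! ### The abstract ODE: existence with a bound, and uniqueness -/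

lemma exists_ode_solution_norm_le {E : Type*} [NormedAddCommGroup E] [NormedSpace ℝ E]
    [CompleteSpace E] {F : E → E} {C : ℝ} (hC : 0 < C)
    (hF : ∀ u, ‖F u‖ ≤ C * (‖u‖ + ‖u‖ ^ 2))
    (hL : ∀ u v, ‖F u - F v‖ ≤ C * (1 + ‖u‖ + ‖v‖) * ‖u - v‖)
    {K : ℝ} (hK : 0 < K) {u₀ : E} (hu₀ : ‖u₀‖ ≤ K) :
    ∃ w : ℝ → E, w 0 = u₀ ∧ (∀ t, ‖w t‖ ≤ 2 * K) ∧
      ∀ t ∈ Icc 0 (1 / (4 * C) / (1 + K)),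
        HasDerivWithinAt w (F (w t)) (Icc 0 (1 / (4 * C) / (1 + K))) t := by
  set T := 1 / (4 * C) / (1 + K) with hT
  have hT0 : 0 ≤ T := by positivity
  have hball : ∀ x ∈ Metric.closedBall u₀ K, ‖x‖ ≤ 2 * K := fun x hx => by
    have h1 := norm_le_norm_add_norm_sub u₀ x
    rw [mem_closedBall_iff_norm'] at hx
    linarith
  let a : NNReal := ⟨K, hK.le⟩
  let L : NNReal := ⟨C * (2 * K + (2 * K) ^ 2), by positivity⟩
  let M : NNReal := ⟨C * (1 + 2 * K + 2 * K), by positivity⟩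
  have hPL : IsPicardLindelof (fun _ => F) (⟨0, left_mem_Icc.2 hT0⟩ : Icc 0 T) u₀ a 0 L M := by
    refine IsPicardLindelof.of_time_independent (fun x hx => ?_) ?_ ?_
    · have h := hball x hx
      refine (hF x).trans ?_
      change _ ≤ C * (2 * K + (2 * K) ^ 2)
      gcongr
    · refine LipschitzOnWith.of_dist_le_mul fun x hx y hy => ?_
      rw [dist_eq_norm, dist_eq_norm]
      refine (hL x y).trans ?_
      change _ ≤ C * (1 + 2 * K + 2 * K) * _
      have h1 := hball x hx
      have h2 := hball y hy
      gcongr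
    -- The curve cannot leave the ball: speed times `T` is `K (1 + 2 K) / (2 (1 + K)) ≤ K`.
    · change C * (2 * K + (2 * K) ^ 2) * max (T - 0) (0 - 0) ≤ K - 0
      rw [sub_zero, sub_zero, sub_zero, max_eq_left hT0, hT, div_div, mul_one_div,
        div_le_iff₀ (by positivity)]
      nlinarith [mul_pos hC hK]
  -- The fixed point itself is kept, since it stays in the ball by construction. `compProj` clamps
  -- time to `[0, T]`, so the bound `2 K` holds at every real `t`.
  obtain ⟨w, hw⟩ := ODE.FunSpace.exists_isFixedPt_next hPL (Metric.mem_closedBall_self le_rfl)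
  refine ⟨w.compProj, ?_, fun t => hball _ (w.compProj_mem_closedBall hPL.mul_max_le),
    fun t ht => ?_⟩
  · have := ODE.FunSpace.compProj_val (α := w) (t := ⟨0, left_mem_Icc.2 hT0⟩)
    rw [this, ← hw, ODE.FunSpace.next_apply₀]
  · apply ODE.hasDerivWithinAt_picard_Icc (left_mem_Icc.2 hT0) hPL.continuousOn_uncurry
      w.continuous_compProj.continuousOn
      (fun _ _ => w.compProj_mem_closedBall hPL.mul_max_le) u₀ ht |>.congr_of_mem _ ht
    intro t' ht'
    nth_rw 1 [← hw]
    rw [ODE.FunSpace.compProj_of_mem ht', ODE.FunSpace.next_apply]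

/-- Both curves are bounded on the compact interval, so `F` is Lipschitz on a ball containing them
and the Grönwall uniqueness theorem applies. No a priori bound on the competing solution is needed.
-/
lemma ode_solution_eqOn {E : Type*} [NormedAddCommGroup E] [NormedSpace ℝ E] {F : E → E} {C : ℝ}
    (hC : 0 < C) (hL : ∀ u v, ‖F u - F v‖ ≤ C * (1 + ‖u‖ + ‖v‖) * ‖u - v‖) {T : ℝ}
    {w z : ℝ → E} (hw : ∀ t ∈ Icc 0 T, HasDerivWithinAt w (F (w t)) (Icc 0 T) t)
    (hz : ∀ t ∈ Icc 0 T, HasDerivWithinAt z (F (z t)) (Icc 0 T) t) (h0 : w 0 = z 0) :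
    EqOn w z (Icc 0 T) := by
  have hwc : ContinuousOn w (Icc 0 T) := fun t ht => (hw t ht).continuousWithinAt
  have hzc : ContinuousOn z (Icc 0 T) := fun t ht => (hz t ht).continuousWithinAt
  obtain ⟨R₁, hR₁⟩ := isCompact_Icc.exists_bound_of_continuousOn hwc
  obtain ⟨R₂, hR₂⟩ := isCompact_Icc.exists_bound_of_continuousOn hzc
  set R := max 0 (max R₁ R₂) with hR
  have hR0 : 0 ≤ R := le_max_left _ _
  have h1R : R₁ ≤ R := (le_max_left _ _).trans (le_max_right _ _)
  have h2R : R₂ ≤ R := (le_max_right _ _).trans (le_max_right _ _)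
  let M : NNReal := ⟨C * (1 + R + R), by positivity⟩
  have hIci : ∀ {f : ℝ → E} {d : E} {t : ℝ}, t ∈ Ico 0 T → HasDerivWithinAt f d (Icc 0 T) t →
      HasDerivWithinAt f d (Ici t) t := fun {f d t} ht hf =>
    hf.mono_of_mem_nhdsWithin (Icc_mem_nhdsGE_of_mem ht)
  refine ODE_solution_unique_of_mem_Icc_right (v := fun _ => F) (K := M)
    (s := fun _ => Metric.closedBall 0 R) (fun t _ => ?_) hwc
    (fun t ht => hIci ht (hw t (Ico_subset_Icc_self ht)))
    (fun t ht => mem_closedBall_zero_iff.2 ((hR₁ t (Ico_subset_Icc_self ht)).trans h1R)) hzc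
    (fun t ht => hIci ht (hz t (Ico_subset_Icc_self ht)))
    (fun t ht => mem_closedBall_zero_iff.2 ((hR₂ t (Ico_subset_Icc_self ht)).trans h2R)) h0
  refine LipschitzOnWith.of_dist_le_mul fun x hx y hy => ?_
  rw [mem_closedBall_zero_iff] at hx hy
  rw [dist_eq_norm, dist_eq_norm]
  refine (hL x y).trans ?_
  change _ ≤ C * (1 + R + R) * _
  gcongr

/-! ### From Fourier coefficients to differentiability in `C^α` -/

namespace HolderFun

variable {α : ℝ}

/-- The `n`-th Fourier coefficient as a continuous linear functional on `C^α`. -/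
def fourierCoeffCLM (hα : 0 < α) (n : ℤ) : HolderFun α →L[ℝ] ℂ :=
  LinearMap.mkContinuous
    { toFun := fun f => fourierCoeff (toComplexFun f) n
      map_add' := fun f g =>
        Torus.fourierCoeff_toComplexFun_add (f.continuous_coe hα) (g.continuous_coe hα) n
      map_smul' := fun c f => by
        rw [coe_smul, Torus.fourierCoeff_toComplexFun_smul, RingHom.id_apply,
          Complex.real_smul] }
    1 fun f => by
      rw [one_mul]
      exact Torus.norm_fourierCoeff_le f.abs_apply_le n

lemma fourierCoeffCLM_apply (hα : 0 < α) (n : ℤ) (f : HolderFun α) :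
    fourierCoeffCLM hα n f = fourierCoeff (toComplexFun f) n := rfl

/-- A vanishing coefficient sequence is summable, so the Fourier series converges pointwise to the
continuous function. -/
lemma eq_zero_of_fourierCoeff_eq_zero (hα : 0 < α) {f : HolderFun α}
    (h : ∀ n, fourierCoeffCLM hα n f = 0) : f = 0 := by
  have hc : Continuous (toComplexFun f) := Complex.continuous_ofReal.comp (f.continuous_coe hα)
  let g : C(Torus, ℂ) := ⟨toComplexFun f, hc⟩
  have hg : fourierCoeff g = 0 := funext h
  ext x
  have h1 := has_pointwise_sum_fourier_series_of_summable (f := g)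
    (by rw [hg]; exact summable_zero) x
  simp only [hg, Pi.zero_apply, zero_smul] at h1
  have h2 : (f x : ℂ) = 0 := h1.unique hasSum_zero
  exact_mod_cast h2

/-- A curve in `C^α` whose Fourier coefficients satisfy a differential equation is differentiable
as a curve in `C^α`. -/
lemma hasDerivWithinAt_of_fourierCoeff (hα : 0 < α) {F : HolderFun α → HolderFun α}
    (hF : Continuous F) {T : ℝ} (hT : 0 < T) {w : ℝ → HolderFun α}
    (hw : ContinuousOn w (Icc 0 T))
    (h : ∀ t ∈ Icc 0 T, ∀ n, HasDerivWithinAt (fun s => fourierCoeffCLM hα n (w s))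
      (fourierCoeffCLM hα n (F (w t))) (Icc 0 T) t) :
    ∀ t ∈ Icc 0 T, HasDerivWithinAt w (F (w t)) (Icc 0 T) t := by
  have h0T : (0 : ℝ) ∈ Icc 0 T := left_mem_Icc.2 hT.le
  -- The curve `z t = w 0 + ∫₀ᵗ F (w s) ds` is differentiable in `C^α` by construction. Each
  -- coefficient of `w - z` has zero derivative and vanishes at `0`, hence `w = z`.
  set z : ℝ → HolderFun α := ODE.picard (fun _ => F) 0 (w 0) w with hz
  have hz' : ∀ t ∈ Icc 0 T, HasDerivWithinAt z (F (w t)) (Icc 0 T) t := fun t ht =>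
    ODE.hasDerivWithinAt_picard_Icc (f := fun _ => F) (u := univ) h0T
      (hF.comp continuous_snd).continuousOn hw (fun _ _ => mem_univ _) (w 0) ht
  have hwz : ∀ t ∈ Icc 0 T, w t = z t := fun t ht => by
    rw [← sub_eq_zero]
    refine eq_zero_of_fourierCoeff_eq_zero hα fun n => ?_
    have hd : ∀ s ∈ Icc 0 T, HasDerivWithinAt (fun s => fourierCoeffCLM hα n (w s - z s)) 0
        (Icc 0 T) s := fun s hs => by
      have h1 := (fourierCoeffCLM hα n).hasFDerivAt.comp_hasDerivWithinAt s (hz' s hs)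
      have h2 := (h s hs n).sub h1
      rw [sub_self] at h2
      refine h2.congr_of_mem (fun r _ => ?_) hs
      rw [map_sub]
      rfl
    have hconst := (convex_Icc (0 : ℝ) T).is_const_of_fderivWithin_eq_zero (𝕜 := ℝ)
      (f := fun s => fourierCoeffCLM hα n (w s - z s))
      (fun s hs => (hd s hs).differentiableWithinAt) (fun s hs => ?_) ht h0T
    · rw [hconst, hz]
      simp
    · rw [(hd s hs).hasFDerivWithinAt.fderivWithin (uniqueDiffOn_Icc hT s hs)]
      ext
      simp
  exact fun t ht => (hz' t ht).congr_of_mem hwz ht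

end HolderFun

end

/-! ### Local well-posedness -/

/-- Local well-posedness in `C^α`, with time of existence uniform in `N`; `N = ⊤` is the full
BBM equation. -/
theorem proposition2p2 (α β : ℝ) (hα₀ : 0 < α) (hα₁ : α < 1) (hβ : 1 < β) :
    ∃ c : ℝ, 0 < c ∧
      ∀ (N : ℕ∞) (K : ℝ), 0 < K →
        ∀ u₀ : Torus → ℝ, holderNorm α u₀ ≤ ENNReal.ofReal K →
          ∃ u : ℝ → Torus → ℝ,
            IsBBMSolution α β N (c / (1 + K)) u₀ u ∧
            (∀ v : ℝ → Torus → ℝ, IsBBMSolution α β N (c / (1 + K)) u₀ v →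
              ∀ t ∈ Set.Icc 0 (c / (1 + K)), v t = u t) ∧
            ∀ t ∈ Set.Icc 0 (c / (1 + K)), holderNorm α (u t) ≤ ENNReal.ofReal (2 * K) := by
  obtain ⟨C, hC, hV⟩ := Torus.exists_vectorField hα₀ hα₁ hβ
  refine ⟨1 / (4 * C), by positivity, fun N K hK u₀ hu₀ => ?_⟩
  obtain ⟨F, hF, hL, hcoef⟩ := hV N
  set T := 1 / (4 * C) / (1 + K) with hT
  have hT0 : 0 < T := by positivity
  let U₀ : HolderFun α := HolderFun.of u₀ (hu₀.trans_lt ENNReal.ofReal_lt_top)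
  have hU₀ : ‖U₀‖ ≤ K := ENNReal.toReal_le_of_le_ofReal hK.le hu₀
  obtain ⟨w, hw0, hwK, hw⟩ := exists_ode_solution_norm_le hC hF hL hK hU₀
  have hFc : Continuous F := by
    rw [continuous_iff_continuousAt]
    intro u
    rw [ContinuousAt, tendsto_iff_norm_sub_tendsto_zero]
    have h1 : Tendsto (fun v => C * (1 + ‖v‖ + ‖u‖) * ‖v - u‖) (𝓝 u) (𝓝 0) := by
      have : Continuous fun v => C * (1 + ‖v‖ + ‖u‖) * ‖v - u‖ := by fun_prop
      simpa using this.tendsto u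
    exact squeeze_zero (fun _ => norm_nonneg _) (fun v => hL v u) h1
  have hCLM : ∀ n, ∀ t ∈ Icc 0 T, HasDerivWithinAt
      (fun s => HolderFun.fourierCoeffCLM hα₀ n (w s))
      (HolderFun.fourierCoeffCLM hα₀ n (F (w t))) (Icc 0 T) t := fun n t ht =>
    (HolderFun.fourierCoeffCLM hα₀ n).hasFDerivAt.comp_hasDerivWithinAt t (hw t ht)
  refine ⟨fun t => w t, ⟨⟨fun t _ => (w t).mem, fun t ht => ?_⟩, ?_, fun t ht n =>
    ⟨_, hCLM n t ht, hcoef (w t) n⟩⟩, fun v hv t ht => ?_, fun t _ => ?_⟩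
  · have h1 : ContinuousWithinAt w (Icc 0 T) t := (hw t ht).continuousWithinAt
    have h2 := ENNReal.tendsto_ofReal (tendsto_iff_norm_sub_tendsto_zero.1 h1)
    rw [ENNReal.ofReal_zero] at h2
    refine h2.congr fun s => ?_
    rw [← HolderFun.holderNorm_eq, HolderFun.coe_sub]
  · rw [hw0]
    rfl
  · classical
    -- Outside `[0, T]` a solution may fail to lie in `C^α`; the default value `0` there is
    -- harmless, as all derivatives are taken within `[0, T]`.
    let V : ℝ → HolderFun α := fun s =>
      if h : v s ∈ holderSpace α then HolderFun.of (v s) h else 0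
    have hVv : ∀ s ∈ Icc 0 T, (V s : Torus → ℝ) = v s := fun s hs => by
      simp only [V, dif_pos (hv.continuous.1 s hs), HolderFun.coe_of]
    have hVc : ContinuousOn V (Icc 0 T) := fun s hs => by
      rw [ContinuousWithinAt, tendsto_iff_norm_sub_tendsto_zero]
      have h1 := (ENNReal.tendsto_toReal ENNReal.zero_ne_top).comp (hv.continuous.2 s hs)
      rw [ENNReal.toReal_zero] at h1
      refine h1.congr' (eventually_mem_nhdsWithin.mono fun r hr => ?_)
      change _ = (holderNorm α (V r - V s : HolderFun α)).toReal
      rw [Function.comp_apply, HolderFun.coe_sub, hVv r hr, hVv s hs]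
    have hVd := HolderFun.hasDerivWithinAt_of_fourierCoeff hα₀ hFc hT0 hVc
      (fun s hs n => by
        obtain ⟨d, hd, hd0⟩ := hv.equation s hs n
        have h1 := hcoef (V s) n
        rw [hVv s hs] at h1
        have h2 : (1 + ((|(n : ℝ)| ^ β : ℝ) : ℂ)) ≠ 0 := by
          have : 0 < 1 + |(n : ℝ)| ^ β := by positivity
          exact_mod_cast this.ne'
        -- Both sides solve the same linear equation, whose factor `1 + |n|^β` is nonzero, so the
        -- equation determines the time derivative.
        have h3 : HolderFun.fourierCoeffCLM hα₀ n (F (V s)) = d := by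
          rw [HolderFun.fourierCoeffCLM_apply]
          refine mul_left_cancel₀ h2 ?_
          linear_combination h1 - hd0
        rw [h3]
        refine hd.congr_of_mem (fun r hr => ?_) hs
        rw [HolderFun.fourierCoeffCLM_apply, hVv r hr])
    have h0 : V 0 = w 0 := by
      rw [hw0]
      ext x
      rw [hVv 0 (left_mem_Icc.2 hT0.le), hv.initial]
      rfl
    rw [← hVv t ht, ode_solution_eqOn hC hL hVd hw h0 ht]
  · rw [HolderFun.holderNorm_eq]
    exact ENNReal.ofReal_le_ofReal (hwK t)
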